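/- Let $S$ be a locally Noetherian scheme, let $\alpha:X\to S$ and $\beta:Y\to S$ be morphisms of schemes, and let $n\ge 0$ be an integer. Assume that $\alpha$ and $\beta$ are smooth and equidimensional of the same relative dimension $n$, i.e. they are smooth and every irreducible component of every fibre of $\alpha$ and of every fibre of $\beta$ has dimension $n$. Let $\mathcal E$ be an $S$-central coherent $X$-$Y$-sheaf-bimodule, i.e. a coherent $\mathcal O_{X\times_S Y}$-module whose (scheme-theoretic) support is finite over both $X$ and $Y$. Let $\mathrm{pr}_1:X\times_S Y\to X$ and $\mathrm{pr}_2:X\times_S Y\to Y$ be the projections. Then $\mathcal E$ is locally free on the left, i.e. $\mathrm{pr}_{1*}\mathcal E$ is a locally free $\mathcal O_X$-module, if and only if $\mathcal E$ is locally free on the right, i.e. $\mathrm{pr}_{2*}\mathcal E$ is a locally free $\mathcal O_Y$-module. -/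

import Mathlib

open CategoryTheory CategoryTheory.Limits AlgebraicGeometry

universe u

noncomputable section

namespace SheafBimodule

/-- A coherent sheaf of modules on a (locally Noetherian) scheme `W`: a quasi-coherent sheaf whose
sections over every affine open `U` form a finitely generated `Γ(W, U)`-module. -/
structure IsCoherent {W : Scheme.{u}} (E : W.Modules) : Prop where
  quasicoherent : SheafOfModules.IsQuasicoherent.{u} E
  finite (U : W.affineOpens) : Module.Finite Γ(W, U.1) Γ(E, U.1)

/-- The ideal sheaf of the scheme-theoretic support of `E`: the largest quasi-coherent ideal sheaf
which annihilates `E`. If `W` is locally Noetherian and `E` is coherent, then the annihilators of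
the modules `Γ(E, U)`, `U` affine open, are compatible with localization, and this ideal sheaf is
`U ↦ Ann Γ(E, U)`; its zero locus is then the set of points where the stalk of `E` is nonzero. -/
def annihilatorIdeal {W : Scheme.{u}} (E : W.Modules) : W.IdealSheafData :=
  Scheme.IdealSheafData.ofIdeals fun U ↦ Module.annihilator Γ(W, U.1) Γ(E, U.1)

/-- The scheme-theoretic support of `E`, a closed subscheme of `W`. -/
abbrev schemeSupport {W : Scheme.{u}} (E : W.Modules) : Scheme.{u} :=
  (annihilatorIdeal E).subscheme

/-- The closed immersion of the scheme-theoretic support of `E` into `W`. -/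
abbrev schemeSupportι {W : Scheme.{u}} (E : W.Modules) : schemeSupport E ⟶ W :=
  (annihilatorIdeal E).subschemeι

variable {S X Y : Scheme.{u}}

/-- `E` is an `S`-central coherent `X`-`Y`-sheaf-bimodule: a coherent sheaf of modules on `X ×_S Y`
whose support is finite over both `X` and `Y`. -/
structure IsShbimod (α : X ⟶ S) (β : Y ⟶ S) (E : (pullback α β).Modules) : Prop where
  coherent : IsCoherent E
  finite_left : IsFinite (schemeSupportι E ≫ pullback.fst α β)
  finite_right : IsFinite (schemeSupportι E ≫ pullback.snd α β)

/-- `E` is locally free on the left: `pr₁_* E` is a locally free sheaf on `X`. -/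
def IsLocallyFreeLeft (α : X ⟶ S) (β : Y ⟶ S) (E : (pullback α β).Modules) : Prop :=
  SheafOfModules.IsLocallyFree.{u} ((Scheme.Modules.pushforward (pullback.fst α β)).obj E)

/-- `E` is locally free on the right: `pr₂_* E` is a locally free sheaf on `Y`. -/
def IsLocallyFreeRight (α : X ⟶ S) (β : Y ⟶ S) (E : (pullback α β).Modules) : Prop :=
  SheafOfModules.IsLocallyFree.{u} ((Scheme.Modules.pushforward (pullback.snd α β)).obj E)

/-- `α` is smooth and equidimensional of relative dimension `n`: it is smooth, and every irreducible
component of every (scheme-theoretic) fibre of `α` has dimension `n`. -/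
structure IsSmoothEquidimensional (α : X ⟶ S) (n : ℕ) : Prop where
  smooth : Smooth α
  dim_eq (s : S) (Z : Set (α.fiber s)) (hZ : Z ∈ irreducibleComponents (α.fiber s)) :
    topologicalKrullDim Z = n

end SheafBimodule

end

/-! The scheme-theoretic support `W` of `E` is finite over `X` and over `Y`, and `E` comes from a
coherent module `F` on `W`. The two pushforwards are finite modules on locally Noetherian schemes,
so they are locally free exactly when they are flat. By symmetry it remains to see that flatness of
`F` over `X` forces flatness of `F` over `Y`.

Locally this concerns standard smooth `R`-algebras `A` and `B` of relative dimension `n`, a finite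
type `R`-algebra `C` quasi-finite over `B`, and a finite `C`-module `M` flat over `A`. As `A` is
étale over `R[t₁, …, tₙ]`, `M` is flat over that polynomial ring; and `B` is étale over `R[u₁, …,
uₙ]`. That this makes `M` flat over `B` is `flat_of_flatVia_aeval`. Localize at a maximal ideal of
`C` to get a local map `B → D` and a finite `D`-module `N`, and let `K` be the residue field of `B`.
The local criterion `flat_of_extVanish_quotient` asks for `Tor₁(K, N) = 0`, which follows from two
facts.

First, a `D`-module that is flat over `R` has flat dimension at most `n` over `B`
(`flatDimLE_of_formallyUnramified`). Second, after localizing `R`, each `t_j` satisfies `x = f(t_j)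
∈ 𝔪_B D` for some monic `f`: its residue class is algebraic over the residue field of `R`, and
quasi-finiteness makes `𝔪_D` the radical of `𝔪_B D`. Such an `x` is regular on `N`, leaves a
quotient flat over a polynomial ring in one variable fewer, and acts by zero on `Tor(K, N)`; so
`Tor_{i+1}(K, N/xN)` surjects onto `Tor_i(K, N)`. After `n` steps `Tor₁(K, N)` is reached from
`Tor_{n+1}` of an `R`-flat module, which vanishes (`extVanish_of_flatVia_aeval`).

Tor is handled through its dual: `Ext^i(K, N^*)`, with `N^*` the character module, and injective
dimension of `N^*` in place of flat dimension of `N`.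

The hypothesis on fibres enters only to identify the number of étale coordinates with `n`
(`HasRelativeDimensionAt.eq_of_isSmoothEquidimensional`). -/

namespace SheafBimodule

open TopologicalSpace Opposite

/-! ### Restriction and gluing of sections of a sheaf of modules. -/

section Restriction

variable {P : Scheme.{u}} (E : P.Modules)

/-- Restriction of sections of a sheaf of modules, as an additive map. -/
noncomputable def res {U V : P.Opens} (h : U ≤ V) : Γ(E, V) →+ Γ(E, U) :=
  (E.presheaf.map (homOfLE h).op).hom

/-- Restriction of functions on a scheme, as a ring homomorphism. -/
noncomputable def resRing {U V : P.Opens} (h : U ≤ V) : Γ(P, V) →+* Γ(P, U) :=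
  (P.presheaf.map (homOfLE h).op).hom

variable {E}

@[simp] lemma res_res {U V W : P.Opens} (h : U ≤ V) (h' : V ≤ W) (m : Γ(E, W)) :
    res E h (res E h' m) = res E (h.trans h') m := by
  simp only [res]
  rw [← homOfLE_comp h h', op_comp, E.presheaf.map_comp]
  rfl

@[simp] lemma resRing_resRing {U V W : P.Opens} (h : U ≤ V) (h' : V ≤ W) (m : Γ(P, W)) :
    resRing h (resRing h' m) = resRing (h.trans h') m := by
  simp only [resRing]
  rw [← homOfLE_comp h h', op_comp, P.presheaf.map_comp]
  rfl

@[simp] lemma res_self {U : P.Opens} (h : U ≤ U) (m : Γ(E, U)) : res E h m = m := by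
  change (E.presheaf.map (𝟙 (op U))) m = m
  rw [E.presheaf.map_id]
  rfl

@[simp] lemma resRing_self {U : P.Opens} (h : U ≤ U) (m : Γ(P, U)) : resRing h m = m := by
  change (P.presheaf.map (𝟙 (op U))) m = m
  rw [P.presheaf.map_id]
  rfl

lemma res_smul {U V : P.Opens} (h : U ≤ V) (c : Γ(P, V)) (m : Γ(E, V)) :
    res E h (c • m) = resRing h c • res E h m :=
  Scheme.Modules.map_smul E (homOfLE h) c m

lemma res_bijective_of_eq {U V : P.Opens} (h : U ≤ V) (h' : V ≤ U) :
    Function.Bijective (res E h) :=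
  Function.bijective_iff_has_inverse.mpr
    ⟨res E h', fun m ↦ by simp, fun m ↦ by simp⟩

lemma eq_of_res_eq {ι : Type*} (U : ι → P.Opens) {V : P.Opens} (hU : ∀ i, U i ≤ V)
    (hV : V ≤ iSup U) {s t : Γ(E, V)} (h : ∀ i, res E (hU i) s = res E (hU i) t) : s = t :=
  TopCat.Sheaf.eq_of_locally_eq' ⟨_, E.isSheaf⟩ U V (fun i ↦ homOfLE (hU i)) hV s t h

lemma existsUnique_res_eq {ι : Type*} (U : ι → P.Opens) {V : P.Opens} (hU : ∀ i, U i ≤ V)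
    (hV : V ≤ iSup U) (s : ∀ i, Γ(E, U i))
    (h : ∀ i j, res E (inf_le_left : U i ⊓ U j ≤ U i) (s i) =
      res E (inf_le_right : U i ⊓ U j ≤ U j) (s j)) :
    ∃! t : Γ(E, V), ∀ i, res E (hU i) t = s i :=
  TopCat.Sheaf.existsUnique_gluing' ⟨_, E.isSheaf⟩ U V (fun i ↦ homOfLE (hU i)) hV s h

lemma eq_of_res_affine_eq {V : P.Opens} {s t : Γ(E, V)}
    (h : ∀ (Q : P.Opens) (_ : IsAffineOpen Q) (hQ : Q ≤ V), res E hQ s = res E hQ t) : s = t := by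
  refine eq_of_res_eq (fun Q : {Q : P.affineOpens // Q.1 ≤ V} ↦ Q.1.1) (fun Q ↦ Q.2) ?_
    fun Q ↦ h _ Q.1.2 Q.2
  intro x hx
  obtain ⟨Q, hQ, hxQ, hQV⟩ := Opens.isBasis_iff_nbhd.mp P.isBasis_affineOpens hx
  exact Opens.mem_iSup.mpr ⟨⟨⟨Q, hQ⟩, hQV⟩, hxQ⟩

end Restriction

section Hom

variable {W P : Scheme.{u}} (i : W ⟶ P)

lemma app_resRing {U V : P.Opens} (h : U ≤ V) (c : Γ(P, V)) :
    i.app U (resRing h c) = resRing (i.preimage_mono h) (i.app V c) := by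
  have := i.naturality (homOfLE h).op
  exact congr($this c)

end Hom

/-! ### Descent of a module to a closed subscheme whose ideal kills it. -/

section Extension

variable {W P : Scheme.{u}} (i : W ⟶ P) [IsClosedImmersion i] (E : P.Modules)

/-- The largest open subset of `P` with preimage `O` under the closed immersion `i : W ⟶ P`. -/
def extOpen (O : W.Opens) : P.Opens :=
  ⟨(i '' (O : Set W)ᶜ)ᶜ,
    (i.isClosedEmbedding.isClosedMap _ O.2.isClosed_compl).isOpen_compl⟩

lemma mem_extOpen {O : W.Opens} {p : P} : p ∈ extOpen i O ↔ ∀ w, i w = p → w ∈ O := by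
  change p ∉ _ ↔ _
  simp only [Set.mem_image, not_exists, not_and]
  exact ⟨fun h w hw ↦ by by_contra hh; exact h w hh hw, fun h w hw hp ↦ hw (h w hp)⟩

lemma le_extOpen {O : W.Opens} {Q : P.Opens} : Q ≤ extOpen i O ↔ i ⁻¹ᵁ Q ≤ O := by
  refine ⟨fun h w hw ↦ (mem_extOpen i).mp (h hw) w rfl, fun h p hp ↦ (mem_extOpen i).mpr ?_⟩
  rintro w rfl
  exact h hp

lemma preimage_extOpen (O : W.Opens) : i ⁻¹ᵁ extOpen i O = O := by
  refine le_antisymm ((le_extOpen i).mp le_rfl) fun w hw ↦ (mem_extOpen i).mpr fun w' h ↦ ?_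
  rwa [i.isClosedEmbedding.injective h]

lemma extOpen_mono : Monotone (extOpen i) := fun O _ h ↦
  (le_extOpen i).mpr ((preimage_extOpen i O).le.trans h)

/-- The sheaf of modules `E` is annihilated by the functions vanishing on the closed subscheme
given by `i`. -/
def IsKilledBy : Prop :=
  ∀ (Q : P.Opens) (_ : IsAffineOpen Q) (c : Γ(P, Q)), i.app Q c = 0 → ∀ m : Γ(E, Q), c • m = 0

variable {E} (hE : IsKilledBy i E)

include hE

variable {i}

omit [IsClosedImmersion i] in
lemma IsKilledBy.smul_eq_zero {Q : P.Opens} {c : Γ(P, Q)} (hc : i.app Q c = 0) (m : Γ(E, Q)) :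
    c • m = 0 := by
  refine eq_of_res_affine_eq fun Q' hQ' h ↦ ?_
  rw [res_smul, map_zero]
  exact hE Q' hQ' _ (by rw [app_resRing, hc, map_zero]) _

omit [IsClosedImmersion i] in
lemma IsKilledBy.smul_eq_smul {Q : P.Opens} {c c' : Γ(P, Q)} (hc : i.app Q c = i.app Q c')
    (m : Γ(E, Q)) : c • m = c' • m := by
  rw [← sub_eq_zero, ← sub_smul]
  exact hE.smul_eq_zero (by rw [map_sub, hc, sub_self]) m

omit [IsClosedImmersion i] in
lemma IsKilledBy.subsingleton {Q : P.Opens} (hQ : i ⁻¹ᵁ Q ≤ ⊥) : Subsingleton Γ(E, Q) := by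
  refine subsingleton_of_forall_eq 0 fun m ↦ ?_
  rw [← one_smul Γ(P, Q) m]
  refine hE.smul_eq_zero ?_ m
  have : Subsingleton Γ(W, i ⁻¹ᵁ Q) := by
    rw [le_bot_iff.mp hQ]; infer_instance
  exact Subsingleton.elim _ _

/-- `Q'` is covered by `Q` and its part outside `W`; over the latter `1` maps to zero on the empty
scheme, so all sections vanish there and nothing is left to glue. -/
lemma IsKilledBy.res_bijective {Q Q' : P.Opens} (h : Q ≤ Q') (h' : i ⁻¹ᵁ Q' ≤ i ⁻¹ᵁ Q) :
    Function.Bijective (res E h) := by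
  let U : Option Unit → P.Opens := fun o ↦ o.elim (extOpen i ⊥ ⊓ Q') (fun _ ↦ Q)
  have hU : ∀ o, U o ≤ Q' := by rintro (_ | _); exacts [inf_le_right, h]
  have hcov : Q' ≤ iSup U := by
    intro p hp
    by_cases hpW : p ∈ Set.range i
    · obtain ⟨w, rfl⟩ := hpW
      exact Opens.mem_iSup.mpr ⟨some (), h' hp⟩
    · exact Opens.mem_iSup.mpr ⟨none, (mem_extOpen i).mpr fun w hw ↦ (hpW ⟨w, hw⟩).elim, hp⟩
  have hsub (Q'' : P.Opens) (hQ : Q'' ≤ extOpen i ⊥) : Subsingleton Γ(E, Q'') :=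
    hE.subsingleton ((le_extOpen i).mp hQ)
  constructor
  · intro s t hst
    refine eq_of_res_eq U hU hcov ?_
    rintro (_ | _)
    · exact (hsub _ inf_le_left).elim _ _
    · exact hst
  · intro s
    obtain ⟨t, ht, -⟩ := existsUnique_res_eq U hU hcov
      (fun o ↦ match o with
        | none => 0
        | some _ => s) (by
      rintro (_ | _) (_ | _)
      · exact (hsub _ (inf_le_left.trans inf_le_left)).elim _ _
      · exact (hsub _ (inf_le_left.trans inf_le_left)).elim _ _
      · exact (hsub _ (inf_le_right.trans inf_le_left)).elim _ _
      · rfl)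
    exact ⟨t, ht (some ())⟩

/-- Over affine opens of `P` a function on `W` lifts to `P`, and two lifts differ by an element that
kills `E`. The local products therefore do not depend on the lift, and they glue. -/
lemma IsKilledBy.existsUnique_smul {O : W.Opens} (s : Γ(W, O)) (m : Γ(E, extOpen i O)) :
    ∃! m' : Γ(E, extOpen i O), ∀ (Q : P.Opens) (hQ : Q ≤ extOpen i O) (c : Γ(P, Q)),
      i.app Q c = resRing ((le_extOpen i).mp hQ) s → res E hQ m' = c • res E hQ m := by
  have hsurj (Q : {Q : P.affineOpens // Q.1 ≤ extOpen i O}) :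
      ∃ c : Γ(P, Q.1.1), i.app _ c = resRing ((le_extOpen i).mp Q.2) s :=
    i.app_surjective _ Q.1.2 _
  choose c hc using hsurj
  obtain ⟨m', hm', -⟩ := existsUnique_res_eq (E := E) (V := extOpen i O)
    (fun Q : {Q : P.affineOpens // Q.1 ≤ extOpen i O} ↦ Q.1.1) (fun Q ↦ Q.2) (by
      intro x hx
      obtain ⟨Q, hQ, hxQ, hQV⟩ := Opens.isBasis_iff_nbhd.mp P.isBasis_affineOpens hx
      exact Opens.mem_iSup.mpr ⟨⟨⟨Q, hQ⟩, hQV⟩, hxQ⟩) (fun Q ↦ c Q • res E Q.2 m) (by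
      intro Q Q'
      rw [res_smul, res_smul, res_res, res_res]
      refine hE.smul_eq_smul ?_ _
      rw [app_resRing, app_resRing, hc, hc, resRing_resRing, resRing_resRing])
  have key : ∀ (Q : P.Opens) (hQ : Q ≤ extOpen i O) (c : Γ(P, Q)),
      i.app Q c = resRing ((le_extOpen i).mp hQ) s → res E hQ m' = c • res E hQ m := by
    intro Q hQ d hd
    refine eq_of_res_affine_eq fun Q' hQ' h ↦ ?_
    rw [res_res, res_smul, res_res, hm' ⟨⟨Q', hQ'⟩, h.trans hQ⟩]
    refine hE.smul_eq_smul ?_ _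
    rw [hc, app_resRing, hd, resRing_resRing]
  refine ⟨m', key, fun m'' hm'' ↦ eq_of_res_affine_eq fun Q hQ h ↦ ?_⟩
  rw [hm'' Q h _ (hc ⟨⟨Q, hQ⟩, h⟩), key Q h _ (hc ⟨⟨Q, hQ⟩, h⟩)]

/-- The action of a function `s` on `W` on the sections of a sheaf killed by the ideal of `W`. -/
noncomputable def IsKilledBy.act {O : W.Opens} (s : Γ(W, O)) (m : Γ(E, extOpen i O)) :
    Γ(E, extOpen i O) :=
  (hE.existsUnique_smul s m).choose

lemma IsKilledBy.res_act {O : W.Opens} (s : Γ(W, O)) (m : Γ(E, extOpen i O))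
    {Q : P.Opens} (hQ : Q ≤ extOpen i O) {c : Γ(P, Q)}
    (hc : i.app Q c = resRing ((le_extOpen i).mp hQ) s) :
    res E hQ (hE.act s m) = c • res E hQ m :=
  (hE.existsUnique_smul s m).choose_spec.1 Q hQ c hc

omit hE in
lemma IsKilledBy.ext_of_lift {O : W.Opens} (s : Γ(W, O)) {m m' : Γ(E, extOpen i O)}
    (h : ∀ (Q : P.Opens) (hQ : Q ≤ extOpen i O) (c : Γ(P, Q)),
      i.app Q c = resRing ((le_extOpen i).mp hQ) s → res E hQ m = res E hQ m') : m = m' := by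
  refine eq_of_res_affine_eq fun Q hQ hQO ↦ ?_
  obtain ⟨c, hc⟩ := i.app_surjective Q hQ (resRing ((le_extOpen i).mp hQO) s)
  exact h Q hQO c hc

/-- The sections of `E` on the largest open subset with preimage `O` as a `Γ(W, O)`-module. -/
noncomputable abbrev IsKilledBy.module (O : W.Opens) : Module Γ(W, O) Γ(E, extOpen i O) where
  smul := hE.act
  one_smul m := IsKilledBy.ext_of_lift 1 fun Q hQ c hc ↦ by
    change res E hQ (hE.act 1 m) = _
    rw [hE.res_act 1 m hQ (c := 1) (by simp), one_smul]
  mul_smul s t m := by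
    refine eq_of_res_affine_eq fun Q hQ hQO ↦ ?_
    obtain ⟨c, hc⟩ := i.app_surjective Q hQ (resRing ((le_extOpen i).mp hQO) s)
    obtain ⟨d, hd⟩ := i.app_surjective Q hQ (resRing ((le_extOpen i).mp hQO) t)
    change res E hQO (hE.act (s * t) m) = res E hQO (hE.act s (hE.act t m))
    rw [hE.res_act _ _ hQO (c := c * d) (by rw [map_mul, map_mul, hc, hd]),
      hE.res_act _ _ hQO hc, hE.res_act _ _ hQO hd, mul_smul]
  smul_zero s := IsKilledBy.ext_of_lift s fun Q hQ c hc ↦ by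
    change res E hQ (hE.act s 0) = _
    rw [hE.res_act s _ hQ hc, map_zero, smul_zero]
  smul_add s m m' := IsKilledBy.ext_of_lift s fun Q hQ c hc ↦ by
    change res E hQ (hE.act s (m + m')) = res E hQ (hE.act s m + hE.act s m')
    rw [map_add, hE.res_act s _ hQ hc, hE.res_act s _ hQ hc, hE.res_act s _ hQ hc, map_add,
      smul_add]
  add_smul s t m := by
    refine eq_of_res_affine_eq fun Q hQ hQO ↦ ?_
    obtain ⟨c, hc⟩ := i.app_surjective Q hQ (resRing ((le_extOpen i).mp hQO) s)
    obtain ⟨d, hd⟩ := i.app_surjective Q hQ (resRing ((le_extOpen i).mp hQO) t)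
    change res E hQO (hE.act (s + t) m) = res E hQO (hE.act s m + hE.act t m)
    rw [map_add, hE.res_act _ _ hQO (c := c + d) (by rw [map_add, map_add, hc, hd]),
      hE.res_act _ _ hQO hc, hE.res_act _ _ hQO hd, add_smul]
  zero_smul m := eq_of_res_affine_eq fun Q hQ hQO ↦ by
    change res E hQO (hE.act 0 m) = _
    rw [hE.res_act 0 m hQO (c := 0) (by simp), zero_smul, map_zero]

lemma IsKilledBy.res_act_extOpen {O O' : W.Opens} (h : O' ≤ O) (s : Γ(W, O))
    (m : Γ(E, extOpen i O)) :
    res E (extOpen_mono i h) (hE.act s m) =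
      hE.act (resRing h s) (res E (extOpen_mono i h) m) := by
  refine IsKilledBy.ext_of_lift (resRing h s) fun Q hQ c hc ↦ ?_
  rw [hE.res_act _ _ hQ hc, res_res, res_res, hE.res_act _ _ _ (hc.trans (resRing_resRing ..))]

/-- The presheaf of modules on `W` underlying the restriction of `E` to `W`. -/
noncomputable def IsKilledBy.presheafOfModules : W.PresheafOfModules :=
  letI (O : (Opens W)ᵒᵖ) : Module (W.ringCatSheaf.obj.obj O)
      (((extOpen_mono i).functor.op ⋙ E.presheaf).obj O) := hE.module O.unop
  PresheafOfModules.ofPresheaf (R := W.ringCatSheaf.obj)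
    ((extOpen_mono i).functor.op ⋙ E.presheaf) fun _ _ f r m ↦
      hE.res_act_extOpen f.unop.le r m

lemma IsKilledBy.isSheaf :
    TopCat.Presheaf.IsSheaf ((extOpen_mono i).functor.op ⋙ E.presheaf : TopCat.Presheaf Ab W) := by
  rw [TopCat.Presheaf.isSheaf_iff_isSheafUniqueGluing]
  intro ι U s hs
  -- The extra member, the complement of `W`, is needed for the empty family, which does not cover
  -- `extOpen i ⊥`. It carries only the zero section.
  let V : Option ι → P.Opens := fun o ↦ o.elim (extOpen i ⊥) (fun j ↦ extOpen i (U j))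
  have hV : ∀ o, V o ≤ extOpen i (iSup U) := by
    rintro (_ | j)
    exacts [extOpen_mono i bot_le, extOpen_mono i (le_iSup U j)]
  have hcov : extOpen i (iSup U) ≤ iSup V := by
    intro p hp
    by_cases hpW : p ∈ Set.range i
    · obtain ⟨w, rfl⟩ := hpW
      obtain ⟨j, hj⟩ := Opens.mem_iSup.mp ((mem_extOpen i).mp hp w rfl)
      exact Opens.mem_iSup.mpr ⟨some j, (mem_extOpen i).mpr fun w' h ↦
        by rwa [i.isClosedEmbedding.injective h]⟩
    · exact Opens.mem_iSup.mpr ⟨none, (mem_extOpen i).mpr fun w hw ↦ (hpW ⟨w, hw⟩).elim⟩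
  have hsub (Q'' : P.Opens) (hQ : Q'' ≤ extOpen i ⊥) : Subsingleton Γ(E, Q'') :=
    hE.subsingleton ((le_extOpen i).mp hQ)
  have hinf (j k) : extOpen i (U j) ⊓ extOpen i (U k) ≤ extOpen i (U j ⊓ U k) :=
    (le_extOpen i).mpr (le_inf ((le_extOpen i).mp inf_le_left) ((le_extOpen i).mp inf_le_right))
  obtain ⟨t, ht, htu⟩ := existsUnique_res_eq (E := E) V hV hcov
      (fun o ↦ match o with
        | none => 0
        | some j => s j) (by
      rintro (_ | j) (_ | k)
      · exact (hsub _ (inf_le_left)).elim _ _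
      · exact (hsub _ (inf_le_left)).elim _ _
      · exact (hsub _ (inf_le_right)).elim _ _
      · have : res E (extOpen_mono i inf_le_left) (s j) =
          res E (extOpen_mono i inf_le_right) (s k) := hs j k
        exact (res_res (hinf j k) _ (s j)).symm.trans
          (congr(res E (hinf j k) $this).trans (res_res (hinf j k) _ (s k))))
  refine ⟨t, fun j ↦ ht (some j), fun t' ht' ↦ htu t' ?_⟩
  rintro (_ | j)
  · exact (hsub _ le_rfl).elim _ _
  · exact ht' j

/-- The restriction to the closed subscheme `W` of a sheaf of modules killed by its ideal. -/
noncomputable def IsKilledBy.restrict : W.Modules where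
  val := hE.presheafOfModules
  isSheaf := hE.isSheaf

end Extension

end SheafBimodule

namespace SheafBimodule

open TopologicalSpace Opposite

/-! ### Local freeness and quasi-coherence tested on open subschemes. -/

section LocallyFree

variable {X : Scheme.{u}} (M : X.Modules)

/-- Restriction along an open immersion, as a functor between categories of sheaves of modules
over sheaves of rings. -/
noncomputable abbrev restrictSheaf {Z : Scheme.{u}} (j : Z ⟶ X) [IsOpenImmersion j] :
    SheafOfModules.{u} X.ringCatSheaf ⥤ SheafOfModules.{u} Z.ringCatSheaf :=
  Scheme.Modules.restrictFunctor j

/-- Modules on the open subscheme `U` as modules on the over site, as a functor between categories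
of sheaves of modules over sheaves of rings. -/
noncomputable abbrev overSheafInverse (U : X.Opens) :
    SheafOfModules.{u} (U : Scheme.{u}).ringCatSheaf ⥤ SheafOfModules.{u} (X.ringCatSheaf.over U) :=
  (Scheme.Modules.overEquiv U).inverse

/-- Modules on the over site as modules on the open subscheme `U`, as a functor between categories
of sheaves of modules over sheaves of rings. -/
noncomputable abbrev overSheafFunctor (U : X.Opens) :
    SheafOfModules.{u} (X.ringCatSheaf.over U) ⥤ SheafOfModules.{u} (U : Scheme.{u}).ringCatSheaf :=
  (Scheme.Modules.overEquiv U).functor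

lemma preservesColimits_restrictSheaf {Z : Scheme.{u}} (j : Z ⟶ X) [IsOpenImmersion j] :
    PreservesColimitsOfSize.{u, u} (restrictSheaf j) :=
  (Scheme.Modules.restrictAdjunction.{u} j).leftAdjoint_preservesColimits

lemma preservesColimits_overSheafInverse (U : X.Opens) :
    PreservesColimitsOfSize.{u, u} (overSheafInverse U) :=
  (Scheme.Modules.overEquiv.{u} U).symm.toAdjunction.leftAdjoint_preservesColimits

lemma preservesColimits_overSheafFunctor (U : X.Opens) :
    PreservesColimitsOfSize.{u, u} (overSheafFunctor U) :=
  (Scheme.Modules.overEquiv.{u} U).toAdjunction.leftAdjoint_preservesColimits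

/-- The restriction of a free sheaf of modules along an open immersion is free. -/
noncomputable def restrictFreeIso {Z : Scheme.{u}} (j : Z ⟶ X) [IsOpenImmersion j] (I : Type u) :
    (SheafOfModules.free I : Z.Modules) ≅
      (Scheme.Modules.restrictFunctor j).obj (SheafOfModules.free I) :=
  have := preservesColimits_restrictSheaf j
  SheafOfModules.mapFreeIso (restrictSheaf j) I (Scheme.Modules.restrictUnitIso j).symm

/-- Restricting to a smaller open immersion preserves freeness. -/
noncomputable def restrictFreeIsoOfComp {Z Z' : Scheme.{u}} (j : Z ⟶ X) [IsOpenImmersion j]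
    (j' : Z' ⟶ Z) [IsOpenImmersion j'] (k : Z' ⟶ X) [IsOpenImmersion k] (hk : j' ≫ j = k)
    (I : Type u) (e : (SheafOfModules.free I : Z.Modules) ≅ M.restrict j) :
    (SheafOfModules.free I : Z'.Modules) ≅ M.restrict k :=
  restrictFreeIso j' I ≪≫ (Scheme.Modules.restrictFunctor j').mapIso e ≪≫
    ((Scheme.Modules.restrictFunctorComp j' j).app M).symm ≪≫
    (Scheme.Modules.restrictFunctorCongr hk).app M

lemma exists_restrict_iso_free (hM : SheafOfModules.IsLocallyFree.{u} M) (x : X) :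
    ∃ (U : X.Opens) (_ : x ∈ U) (I : Type u),
      Nonempty ((SheafOfModules.free I : (U : Scheme.{u}).Modules) ≅ M.restrict U.ι) := by
  obtain ⟨q, hq⟩ := hM.exists_isLocallyFreeData
  have hcov := (Opens.coversTop_iff _ _).mp q.coversTop
  obtain ⟨i, hi⟩ := hcov.exists_mem x
  refine ⟨q.X i, hi, (q.generators i).I, ⟨?_⟩⟩
  have := hq.isIso i
  let e := asIso (q.generators i).π
  have := preservesColimits_overSheafFunctor (q.X i)
  exact SheafOfModules.mapFreeIso (overSheafFunctor (q.X i)) _ (Iso.refl _) ≪≫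
    (overSheafFunctor (q.X i)).mapIso e ≪≫ (Scheme.Modules.overFunctorEquiv (q.X i)).app M

/-- An isomorphism of sheaves of modules over the over site of `U` from an isomorphism on `U`. -/
noncomputable def overIsoOfRestrictIso (U : X.Opens) (N : (U : Scheme.{u}).Modules)
    (e : N ≅ M.restrict U.ι) :
    (overSheafInverse U).obj N ≅ SheafOfModules.over.{u} (R := X.ringCatSheaf) M U :=
  (Scheme.Modules.overEquiv U).inverse.mapIso
      (e ≪≫ ((Scheme.Modules.overFunctorEquiv U).app M).symm) ≪≫
    ((Scheme.Modules.overEquiv U).unitIso.app _).symm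

/-- The structure sheaf on the over site of `U`. -/
noncomputable def overSheafInverseUnit (U : X.Opens) :
    SheafOfModules.unit (X.ringCatSheaf.over U) ≅ (overSheafInverse U).obj (SheafOfModules.unit _) :=
  (Opens.sheafOfModulesEquivOverInverseUnit U X.ringCatSheaf).symm

/-- Generating sections of a free module on the over site of `U`. -/
noncomputable def overFreeGeneratingSections (U : X.Opens) (I : Type u) :
    ((overSheafInverse U).obj (SheafOfModules.free I)).GeneratingSections :=
  have := preservesColimits_overSheafInverse U
  (SheafOfModules.free.generatingSections I).map (overSheafInverse U) (overSheafInverseUnit U)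

lemma isIso_overFreeGeneratingSections_π (U : X.Opens) (I : Type u) :
    IsIso (overFreeGeneratingSections U I).π := by
  have := preservesColimits_overSheafInverse U
  have : IsIso (SheafOfModules.free.generatingSections
      (R := (U : Scheme.{u}).ringCatSheaf) I).π := by
    rw [SheafOfModules.free.generatingSections_π]; exact IsIso.id _
  exact SheafOfModules.instIsIsoπMap (SheafOfModules.free.generatingSections I)
    (overSheafInverse U) (overSheafInverseUnit U)

lemma exists_generatingSections_over (U : X.Opens) (I : Type u)
    (e : (SheafOfModules.free I : (U : Scheme.{u}).Modules) ≅ M.restrict U.ι) :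
    ∃ σ : (SheafOfModules.over.{u} (R := X.ringCatSheaf) M U).GeneratingSections, IsIso σ.π := by
  let p := (overIsoOfRestrictIso M U (SheafOfModules.free I) e).hom
  have hp : IsIso p := Iso.isIso_hom _
  refine ⟨(overFreeGeneratingSections U I).ofEpi p, ?_⟩
  have hG := isIso_overFreeGeneratingSections_π U I
  have := (overFreeGeneratingSections U I).ofEpi_π p
  exact this ▸ IsIso.comp_isIso' hG hp

lemma isLocallyFree_of_restrict_iso_free
    (h : ∀ x : X, ∃ (U : X.Opens) (_ : x ∈ U) (I : Type u),
      Nonempty ((SheafOfModules.free I : (U : Scheme.{u}).Modules) ≅ M.restrict U.ι)) :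
    SheafOfModules.IsLocallyFree.{u} M := by
  choose U hxU I e using h
  choose σ hσ using fun x ↦ exists_generatingSections_over M (U x) (I x) (e x).some
  let q : SheafOfModules.LocalGeneratorsData.{u} (R := X.ringCatSheaf) M :=
    { I := X
      X := U
      coversTop := (Opens.coversTop_iff _ _).mpr (by
        rw [IsOpenCover, eq_top_iff]
        exact fun x _ ↦ Opens.mem_iSup.mpr ⟨x, hxU x⟩)
      generators := σ }
  have : q.IsLocallyFreeData := { isIso := fun i ↦ hσ i }
  exact q.isLocallyFree

lemma isQuasicoherent_of_restrict_presentation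
    (h : ∀ x : X, ∃ (U : X.Opens) (_ : x ∈ U),
      Nonempty (SheafOfModules.Presentation.{u} (R := (U : Scheme.{u}).ringCatSheaf)
        (M.restrict U.ι))) :
    SheafOfModules.IsQuasicoherent.{u} M := by
  choose U hxU p using h
  have (x : X) := preservesColimits_overSheafInverse (U x)
  let q : SheafOfModules.QuasicoherentData.{u} (R := X.ringCatSheaf) M :=
    { I := X
      X := U
      coversTop := (Opens.coversTop_iff _ _).mpr (by
        rw [IsOpenCover, eq_top_iff]
        exact fun x _ ↦ Opens.mem_iSup.mpr ⟨x, hxU x⟩)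
      presentation x := ((p x).some.map (overSheafInverse (U x)) (overSheafInverseUnit (U x))).ofIsIso
          (overIsoOfRestrictIso M (U x) _ (Iso.refl _)).hom }
  exact q.isQuasicoherent

end LocallyFree

end SheafBimodule

namespace SheafBimodule

open TopologicalSpace Opposite

/-! ### Quasi-coherence on an affine open as localization of sections. -/

section Localizing

variable {X : Scheme.{u}} (M : X.Modules)

/-- Sections of `M` over the basic opens of `U` are obtained by localization from those over `U`. -/
structure IsLocalizingOn (U : X.Opens) : Prop where
  exists_pow_smul_eq_zero (d : Γ(X, U)) (t : Γ(M, U)) (h : res M (X.basicOpen_le d) t = 0) :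
    ∃ n : ℕ, d ^ n • t = 0
  exists_res_eq (d : Γ(X, U)) (s : Γ(M, X.basicOpen d)) :
    ∃ (n : ℕ) (t : Γ(M, U)), res M (X.basicOpen_le d) t = resRing (X.basicOpen_le d) (d ^ n) • s

variable {M} {U : X.Opens} (hU : IsAffineOpen U)

lemma fromSpec_appIso_inv {O : (Spec Γ(X, U)).Opens} {V : X.Opens} (h : V ≤ hU.fromSpec ''ᵁ O)
    (hV : V ≤ U) (r : Γ(X, U)) :
    resRing h ((hU.fromSpec.appIso O).inv ((Spec Γ(X, U)).presheaf.map O.leTop.op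
      ((Scheme.ΓSpecIso Γ(X, U)).inv r))) = resRing hV r := by
  have hle : O ≤ hU.fromSpec ⁻¹ᵁ U := by rw [hU.fromSpec_preimage_self]; exact le_top
  have h1 : (Scheme.ΓSpecIso Γ(X, U)).inv ≫ (Spec Γ(X, U)).presheaf.map O.leTop.op =
      hU.fromSpec.app U ≫ (Spec Γ(X, U)).presheaf.map (homOfLE hle).op := by
    rw [hU.fromSpec_app_self, Category.assoc, ← Functor.map_comp]
    rfl
  have h2 : (Scheme.ΓSpecIso Γ(X, U)).inv ≫ (Spec Γ(X, U)).presheaf.map O.leTop.op ≫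
      (hU.fromSpec.appIso O).inv ≫ X.presheaf.map (homOfLE h).op =
      X.presheaf.map (homOfLE hV).op := by
    rw [reassoc_of% h1, Scheme.Hom.appIso_inv_naturality_assoc, Scheme.Hom.app_appIso_inv_assoc]
    exact (congrArg _ (X.presheaf.map_comp _ _).symm).trans (X.presheaf.map_comp _ _).symm
  exact congr($h2 r)

/-- Sections of the pullback of `M` to `Spec Γ(X, U)` as sections of `M`. -/
noncomputable def fromSpecEquiv {O : (Spec Γ(X, U)).Opens} {V : X.Opens}
    (h : hU.fromSpec ''ᵁ O = V) : Γ(M.restrict hU.fromSpec, O) ≃+ Γ(M, V) :=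
  AddEquiv.ofBijective (res M h.ge : Γ(M, hU.fromSpec ''ᵁ O) →+ Γ(M, V))
    (res_bijective_of_eq h.ge h.le)

lemma fromSpecEquiv_smul {O : (Spec Γ(X, U)).Opens} {V : X.Opens}
    (h : hU.fromSpec ''ᵁ O = V) (hV : V ≤ U) (r : Γ(X, U)) (m : Γ(M.restrict hU.fromSpec, O)) :
    fromSpecEquiv hU h (r • m) = resRing hV r • fromSpecEquiv hU h m := by
  rw [← fromSpec_appIso_inv hU h.ge hV]
  exact res_smul (E := M) h.ge _ m

lemma fromSpecEquiv_map {O O' : (Spec Γ(X, U)).Opens} {V V' : X.Opens}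
    (h : hU.fromSpec ''ᵁ O = V) (h' : hU.fromSpec ''ᵁ O' = V') (hO : O' ≤ O) (hV : V' ≤ V)
    (m : Γ(M.restrict hU.fromSpec, O)) :
    fromSpecEquiv hU h' ((M.restrict hU.fromSpec).presheaf.map (homOfLE hO).op m) =
      res M hV (fromSpecEquiv hU h m) := by
  exact (res_res (E := M) h'.ge (Scheme.Hom.image_mono _ hO) m).trans
    (res_res (E := M) hV h.ge m).symm

lemma fromSpec_image_top' : hU.fromSpec ''ᵁ ⊤ = U := by
  rw [Scheme.Hom.image_top_eq_opensRange, hU.opensRange_fromSpec]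

/-- Only additive equivalences compatible with the actions are required, so the sections over `Spec
Γ(X, U)` and over `X` need not be given a common module structure. -/
lemma isLocalizedModule_powers_iff_of_addEquiv {R A B A' B' : Type*} [CommRing R] [AddCommGroup A]
    [AddCommGroup B] [AddCommGroup A'] [AddCommGroup B'] [Module R A] [Module R B] [Module R A']
    (f : A →ₗ[R] B) (ρ : A' →+ B') (act : R → B' → B') (e : A ≃+ A') (e' : B ≃+ B')
    (he : ∀ (r : R) m, e (r • m) = r • e m) (he' : ∀ (r : R) m, e' (r • m) = act r (e' m))
    (hres : ∀ m, e' (f m) = ρ (e m)) (d : R) (hd : IsUnit (algebraMap R (Module.End R B) d)) :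
    IsLocalizedModule (.powers d) f ↔ (∀ t, ρ t = 0 → ∃ n : ℕ, d ^ n • t = 0) ∧
      ∀ s, ∃ (n : ℕ) (t : A'), ρ t = act (d ^ n) s := by
  constructor
  · intro H
    constructor
    · intro t ht
      have h1 : f (e.symm t) = f 0 := e'.injective (by simp [hres, ht])
      obtain ⟨⟨_, n, rfl⟩, hn⟩ := H.exists_of_eq h1
      have h2 : d ^ n • e.symm t = d ^ n • (0 : A) := hn
      exact ⟨n, by simpa [he] using congrArg e h2⟩
    · intro s
      obtain ⟨⟨t, ⟨_, n, rfl⟩⟩, ht⟩ := IsLocalizedModule.surj (Submonoid.powers d) f (e'.symm s)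
      refine ⟨n, e t, ?_⟩
      rw [← hres, ← ht]
      exact (he' _ _).trans (by simp)
  · rintro ⟨h1, h2⟩
    refine ⟨?_, ?_, ?_⟩
    · rintro ⟨_, n, rfl⟩
      exact (map_pow (algebraMap R (Module.End R B)) d n).symm ▸ hd.pow n
    · intro s
      obtain ⟨n, t, ht⟩ := h2 (e' s)
      refine ⟨⟨e.symm t, ⟨d ^ n, n, rfl⟩⟩, e'.injective ?_⟩
      rw [hres, e.apply_symm_apply, ht]
      exact he' _ _
    · intro x y hxy
      obtain ⟨n, hn⟩ := h1 (e (x - y)) (by rw [← hres, map_sub, hxy, sub_self, map_zero])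
      rw [← he, ← map_zero e] at hn
      refine ⟨⟨d ^ n, n, rfl⟩, sub_eq_zero.mp ?_⟩
      rw [← smul_sub]
      exact e.injective hn

lemma isLocalizingOn_iff :
    IsLocalizingOn M U ↔ IsIso (M.restrict hU.fromSpec).fromTildeΓ := by
  rw [isIso_fromTildeΓ_iff_isLocalizing]
  let D (d : Γ(X, U)) : (Spec Γ(X, U)).Opens := PrimeSpectrum.basicOpen d
  have key (d : Γ(X, U)) := isLocalizedModule_powers_iff_of_addEquiv
    ((modulesSpecToSheaf.obj (M.restrict hU.fromSpec)).obj.map (D d).leTop.op).hom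
    (res M (X.basicOpen_le d)) (fun r m ↦ resRing (X.basicOpen_le d) r • m)
    (fromSpecEquiv (M := M) hU (fromSpec_image_top' hU))
    (fromSpecEquiv (M := M) (O := D d) hU (hU.fromSpec_image_basicOpen d))
    (fun r m ↦ (fromSpecEquiv_smul hU _ le_rfl r m).trans (by rw [resRing_self]; rfl))
    (fun r m ↦ fromSpecEquiv_smul hU _ _ r m) (fun m ↦ fromSpecEquiv_map hU _ _ _ _ m) d
    ((M.restrict hU.fromSpec).isUnit_algebraMap_end_of_le_basicOpen d le_rfl)
  refine Iff.trans ?_ (forall_congr' key).symm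
  exact ⟨fun h d ↦ ⟨h.1 d, h.2 d⟩, fun h ↦ ⟨fun d ↦ (h d).1, fun d ↦ (h d).2⟩⟩

include hU in
lemma isLocalizingOn_of_isQuasicoherent (hM : SheafOfModules.IsQuasicoherent.{u} M) :
    IsLocalizingOn M U :=
  (isLocalizingOn_iff hU).mpr inferInstance

end Localizing

end SheafBimodule

namespace SheafBimodule

open TopologicalSpace Opposite

/-! ### Freeness of sections versus local freeness of sheaves. -/

section LocalizingFree

lemma free_top_of_iso_free {R : CommRingCat.{u}} (N : (Spec R).Modules) (I : Type u)
    (φ : (SheafOfModules.free I : (Spec R).Modules) ≅ N) : Module.Free R Γ(N, ⊤) := by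
  let ψ : ModuleCat.of R (I →₀ R) ≅ (modulesSpecToSheaf.obj N).obj.obj (op ⊤) :=
    tilde.isoTop _ ≪≫ (moduleSpecΓFunctor (R := R)).mapIso (tildeFinsupp I ≪≫ φ)
  exact Module.Free.of_equiv (M' := Γ(N, ⊤)) ψ.toLinearEquiv

lemma exists_iso_free_of_free_top {R : CommRingCat.{u}} (N : (Spec R).Modules)
    (hN : IsIso N.fromTildeΓ) (h : Module.Free R Γ(N, ⊤)) :
    ∃ I : Type u, Nonempty ((SheafOfModules.free I : (Spec R).Modules) ≅ N) := by
  let b := Module.Free.chooseBasis R Γ(N, ⊤)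
  let ψ : ModuleCat.of R (Module.Free.ChooseBasisIndex R Γ(N, ⊤) →₀ R) ≅
    (modulesSpecToSheaf.obj N).obj.obj (op ⊤) := b.repr.symm.toModuleIso
  exact ⟨_, ⟨(tildeFinsupp _).symm ≪≫ (tilde.functor R).mapIso ψ ≪≫
    @asIso _ _ _ _ N.fromTildeΓ hN⟩⟩

variable {X : Scheme.{u}} {M : X.Modules}

/-- Sections over an affine open `U` as a module over the ring of functions on `U`. -/
noncomputable def fromSpecTopEquiv {U : X.Opens} (hU : IsAffineOpen U) :
    Γ(M.restrict hU.fromSpec, ⊤) ≃ₗ[Γ(X, U)] Γ(M, U) where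
  __ := fromSpecEquiv (M := M) hU (fromSpec_image_top' hU)
  map_smul' r m := (fromSpecEquiv_smul hU _ le_rfl r m).trans (by rw [resRing_self]; rfl)

lemma exists_free_of_isLocallyFree (hM : SheafOfModules.IsLocallyFree.{u} M) (x : X) :
    ∃ (U₀ : X.Opens) (_ : x ∈ U₀), ∀ (U : X.Opens) (_ : IsAffineOpen U) (_ : U ≤ U₀),
      Module.Free Γ(X, U) Γ(M, U) := by
  obtain ⟨U₀, hx, I, ⟨φ⟩⟩ := exists_restrict_iso_free M hM x
  refine ⟨U₀, hx, fun U hU hle ↦ ?_⟩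
  let j' : Spec Γ(X, U) ⟶ U₀ := IsOpenImmersion.lift U₀.ι hU.fromSpec (by
    rw [hU.range_fromSpec, Scheme.Opens.range_ι]
    exact hle)
  have hj' : j' ≫ U₀.ι = hU.fromSpec := IsOpenImmersion.lift_fac ..
  have : IsOpenImmersion j' := by
    have : IsOpenImmersion (j' ≫ U₀.ι) := hj' ▸ inferInstance
    exact IsOpenImmersion.of_comp j' U₀.ι
  have := free_top_of_iso_free _ _ (restrictFreeIsoOfComp M U₀.ι j' hU.fromSpec hj' I φ)
  exact Module.Free.of_equiv (fromSpecTopEquiv hU)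

lemma isLocallyFree_of_free
    (h : ∀ x : X, ∃ (U : X.Opens) (_ : x ∈ U) (_ : IsAffineOpen U),
      IsLocalizingOn M U ∧ Module.Free Γ(X, U) Γ(M, U)) : SheafOfModules.IsLocallyFree.{u} M := by
  refine isLocallyFree_of_restrict_iso_free M fun x ↦ ?_
  obtain ⟨U, hx, hU, hloc, hfree⟩ := h x
  obtain ⟨I, ⟨φ⟩⟩ := exists_iso_free_of_free_top _ ((isLocalizingOn_iff hU).mp hloc)
    (Module.Free.of_equiv (fromSpecTopEquiv hU).symm)
  exact ⟨U, hx, I, ⟨restrictFreeIsoOfComp M hU.fromSpec hU.isoSpec.hom U.ι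
    (hU.isoSpec_hom_fromSpec) I φ⟩⟩

/-- The restriction of a presentation along an open immersion. -/
noncomputable def presentationRestrict {Z : Scheme.{u}} {N : X.Modules}
    (P : SheafOfModules.Presentation.{u} (R := X.ringCatSheaf) N) (j : Z ⟶ X) [IsOpenImmersion j] :
    SheafOfModules.Presentation.{u} (R := Z.ringCatSheaf) (N.restrict j) :=
  have := preservesColimits_restrictSheaf j
  P.map (restrictSheaf j) (Scheme.Modules.restrictUnitIso j).symm

/-- A presentation of a localizing sheaf of modules on an affine open. -/
noncomputable def presentationOfIsLocalizingOn {U : X.Opens} (hU : IsAffineOpen U)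
    (h : IsLocalizingOn M U) :
    SheafOfModules.Presentation.{u} (R := (U : Scheme.{u}).ringCatSheaf) (M.restrict U.ι) :=
  have := (isLocalizingOn_iff hU).mp h
  let N := (modulesSpecToSheaf.obj (M.restrict hU.fromSpec)).presheaf.obj (op ⊤)
  let P := presentationTilde N Set.univ (by simp) _ (Submodule.span_eq _)
  let φ : (tilde N).restrict hU.isoSpec.hom ≅ M.restrict U.ι :=
    (Scheme.Modules.restrictFunctor hU.isoSpec.hom).mapIso
      (asIso (M.restrict hU.fromSpec).fromTildeΓ) ≪≫
    ((Scheme.Modules.restrictFunctorComp hU.isoSpec.hom hU.fromSpec).app M).symm ≪≫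
    (Scheme.Modules.restrictFunctorCongr hU.isoSpec_hom_fromSpec).app M
  let p : SheafOfModules.Hom (R := (U : Scheme.{u}).ringCatSheaf)
    ((tilde N).restrict hU.isoSpec.hom) (M.restrict U.ι) := φ.hom
  @SheafOfModules.Presentation.ofIsIso _ _ _ _ _ _ _ _ p (Iso.isIso_hom φ)
    (presentationRestrict P hU.isoSpec.hom)

lemma isQuasicoherent_of_isLocalizingOn
    (h : ∀ x : X, ∃ (U : X.Opens) (_ : x ∈ U) (_ : IsAffineOpen U), IsLocalizingOn M U) :
    SheafOfModules.IsQuasicoherent.{u} M := by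
  refine isQuasicoherent_of_restrict_presentation M fun x ↦ ?_
  obtain ⟨U, hx, hU, hloc⟩ := h x
  exact ⟨U, hx, ⟨presentationOfIsLocalizingOn hU hloc⟩⟩

end LocalizingFree

end SheafBimodule

namespace SheafBimodule

open TopologicalSpace Opposite

/-! ### Flatness through a ring homomorphism, and localization on the source. -/

section FlatVia

/-- `M` is flat as a module over `A`, where `A` acts through the ring homomorphism `φ`. -/
def FlatVia {A C : Type*} [CommRing A] [CommRing C] (φ : A →+* C) (M : Type*) [AddCommGroup M]
    [Module C M] : Prop :=
  @Module.Flat A M _ _ (Module.compHom M φ)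

lemma flatVia_algebraMap {A C M : Type*} [CommRing A] [CommRing C] [Algebra A C] [AddCommGroup M]
    [Module C M] [Module A M] [IsScalarTower A C M] :
    FlatVia (algebraMap A C) M ↔ Module.Flat A M := by
  have : Module.compHom M (algebraMap A C) = ‹Module A M› :=
    Module.ext' _ _ fun a m ↦ algebraMap_smul C a m
  rw [FlatVia, this]

lemma FlatVia.of_equiv {A C C' M M' : Type*} [CommRing A] [CommRing C] [CommRing C']
    [AddCommGroup M] [Module C M] [AddCommGroup M'] [Module C' M'] {φ : A →+* C} {φ' : A →+* C'}
    (h : FlatVia φ M) (e : M ≃+ M') (he : ∀ a m, e (φ a • m) = φ' a • e m) : FlatVia φ' M' := by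
  let := Module.compHom M φ
  let := Module.compHom M' φ'
  have : Module.Flat A M := h
  let e' : M ≃ₗ[A] M' := { e with map_smul' := he }
  exact Module.Flat.of_linearEquiv e'.symm

-- The localization is over `C`, not over `A`. Tensoring with an `A`-module commutes with it, and
-- localizing preserves injectivity.
open TensorProduct in
lemma flat_of_isLocalizedModule_of_isScalarTower {A C M M' : Type*} [CommRing A] [CommRing C]
    [Algebra A C] [AddCommGroup M] [Module C M] [Module A M] [IsScalarTower A C M]
    [AddCommGroup M'] [Module C M'] [Module A M'] [IsScalarTower A C M']
    (p : Submonoid C) (g : M →ₗ[C] M') [IsLocalizedModule p g] [Module.Flat A M] :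
    Module.Flat A M' := by
  have H : Module.Flat A M := inferInstance
  rw [Module.Flat.iff_lTensor_injectiveₛ] at H ⊢
  simp_rw [← AlgebraTensorModule.coe_lTensor (A := C)] at H ⊢
  intro P _ _ N
  have := IsLocalizedModule.map_injective p (AlgebraTensorModule.rTensor A N g)
    (AlgebraTensorModule.rTensor A P g) _ (H N)
  rwa [IsLocalizedModule.map_lTensor] at this

lemma FlatVia.of_isLocalizedModule {A C M M' : Type*} [CommRing A] [CommRing C]
    [AddCommGroup M] [Module C M] [AddCommGroup M'] [Module C M'] {φ : A →+* C}
    (h : FlatVia φ M) (p : Submonoid C) (g : M →ₗ[C] M') [IsLocalizedModule p g] :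
    FlatVia φ M' := by
  let := φ.toAlgebra
  let := Module.compHom M φ
  let := Module.compHom M' φ
  have : IsScalarTower A C M := IsScalarTower.of_algebraMap_smul fun _ _ ↦ rfl
  have : IsScalarTower A C M' := IsScalarTower.of_algebraMap_smul fun _ _ ↦ rfl
  have : Module.Flat A M := h
  exact flat_of_isLocalizedModule_of_isScalarTower p g

lemma FlatVia.of_isLocalized_span {A C M : Type*} [CommRing A] [CommRing C]
    [AddCommGroup M] [Module C M] {φ : A →+* C} (s : Set C) (hs : Ideal.span s = ⊤)
    (M' : s → Type*) [∀ r, AddCommGroup (M' r)] [∀ r, Module C (M' r)]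
    (g : ∀ r, M →ₗ[C] M' r) [∀ r : s, IsLocalizedModule.Away r.1 (g r)]
    (h : ∀ r, FlatVia φ (M' r)) : FlatVia φ M := by
  let := φ.toAlgebra
  let := Module.compHom M φ
  let (r : s) : Module A (M' r) := Module.compHom (M' r) φ
  have : IsScalarTower A C M := IsScalarTower.of_algebraMap_smul fun _ _ ↦ rfl
  have (r : s) : IsScalarTower A C (M' r) := IsScalarTower.of_algebraMap_smul fun _ _ ↦ rfl
  exact Module.flat_of_isLocalized_span C M s hs M' g h

end FlatVia

/-! ### Finiteness and flatness on basic opens. -/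

section Basic

variable {X : Scheme.{u}} {F : X.Modules} {O : X.Opens}

/-- Sections over a basic open of `O` as a module over the functions on `O`. -/
noncomputable abbrev basicOpenModule (d : Γ(X, O)) : Module Γ(X, O) Γ(F, X.basicOpen d) :=
  Module.compHom _ (resRing (X.basicOpen_le d))

/-- Restriction to a basic open as a linear map. -/
noncomputable def resBasicOpen (F : X.Modules) (d : Γ(X, O)) :
    letI := basicOpenModule (F := F) d
    Γ(F, O) →ₗ[Γ(X, O)] Γ(F, X.basicOpen d) :=
  letI := basicOpenModule (F := F) d
  { res F (X.basicOpen_le d) with map_smul' := fun c m ↦ res_smul _ c m }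

lemma isUnit_resRing_basicOpen (d : Γ(X, O)) : IsUnit (resRing (X.basicOpen_le d) d) :=
  RingedSpace.isUnit_res_basicOpen _ d

lemma IsLocalizingOn.isLocalizedModule (h : IsLocalizingOn F O) (d : Γ(X, O)) :
    letI := basicOpenModule (F := F) d
    IsLocalizedModule.Away d (resBasicOpen F d) := by
  let := basicOpenModule (F := F) d
  refine (isLocalizedModule_powers_iff_of_addEquiv (resBasicOpen F d) (res F (X.basicOpen_le d))
    (fun r m ↦ resRing (X.basicOpen_le d) r • m) (.refl _) (.refl _) (fun _ _ ↦ rfl)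
    (fun _ _ ↦ rfl) (fun _ ↦ rfl) d ?_).mpr
    ⟨h.exists_pow_smul_eq_zero d, h.exists_res_eq d⟩
  have hu := (isUnit_resRing_basicOpen d).map
    (algebraMap _ (Module.End Γ(X, X.basicOpen d) Γ(F, X.basicOpen d)))
  rw [Module.End.isUnit_iff] at hu ⊢
  exact hu

lemma IsLocalizingOn.finite_basicOpen (h : IsLocalizingOn F O) (d : Γ(X, O))
    [hfin : Module.Finite Γ(X, O) Γ(F, O)] :
    Module.Finite Γ(X, X.basicOpen d) Γ(F, X.basicOpen d) := by
  obtain ⟨T, hT⟩ := hfin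
  classical
  refine ⟨T.image (res F (X.basicOpen_le d)), eq_top_iff.mpr fun s _ ↦ ?_⟩
  obtain ⟨n, t, ht⟩ := h.exists_res_eq d s
  have ht' : res F (X.basicOpen_le d) t ∈
      Submodule.span Γ(X, X.basicOpen d) (T.image (res F (X.basicOpen_le d)) : Set _) := by
    have : t ∈ Submodule.span Γ(X, O) (T : Set Γ(F, O)) := hT ▸ trivial
    clear ht
    induction this using Submodule.span_induction with
    | mem x hx => exact Submodule.subset_span (by simpa using ⟨x, hx, rfl⟩)
    | zero => simp
    | add x y _ _ hx hy => exact (map_add (res F _) x y) ▸ add_mem hx hy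
    | smul a x _ hx => exact (res_smul (E := F) (X.basicOpen_le d) a x) ▸ Submodule.smul_mem _ _ hx
  rw [ht] at ht'
  have hu : IsUnit (resRing (X.basicOpen_le d) (d ^ n)) := by
    rw [map_pow]; exact (isUnit_resRing_basicOpen d).pow n
  exact (Submodule.smul_mem_iff_of_isUnit _ hu).mp ht'

lemma span_eq_top_of_forall_exists_mem_basicOpen (hO : IsAffineOpen O) (s : Set Γ(X, O))
    (h : ∀ x ∈ O, ∃ d ∈ s, x ∈ X.basicOpen d) : Ideal.span s = ⊤ := by
  rw [← hO.self_le_iSup_basicOpen_iff]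
  intro x hx
  obtain ⟨d, hd, hxd⟩ := h x hx
  exact Opens.mem_iSup.mpr ⟨⟨d, hd⟩, hxd⟩

lemma IsLocalizingOn.finite_of_basicOpen (hO : IsAffineOpen O) (h : IsLocalizingOn F O)
    (hfin : ∀ x ∈ O, ∃ d : Γ(X, O), x ∈ X.basicOpen d ∧
      Module.Finite Γ(X, X.basicOpen d) Γ(F, X.basicOpen d)) :
    Module.Finite Γ(X, O) Γ(F, O) := by
  let s : Set Γ(X, O) := {d | Module.Finite Γ(X, X.basicOpen d) Γ(F, X.basicOpen d)}
  have hs : Ideal.span s = ⊤ := span_eq_top_of_forall_exists_mem_basicOpen hO s fun x hx ↦ by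
    obtain ⟨d, hd, hd'⟩ := hfin x hx
    exact ⟨d, hd', hd⟩
  let (d : s) := basicOpenModule (F := F) d.1
  have (d : s) : IsScalarTower Γ(X, O) Γ(X, X.basicOpen d.1) Γ(F, X.basicOpen d.1) :=
    IsScalarTower.of_algebraMap_smul fun _ _ ↦ rfl
  exact Module.Finite.of_localizationSpan' s hs (h₁ := fun d ↦ hO.isLocalization_basicOpen d.1)
    (fun d : s ↦ resBasicOpen F d.1) (h₂ := fun d ↦ h.isLocalizedModule d.1) fun d ↦ d.2

lemma IsLocalizingOn.flatVia_basicOpen {A : Type*} [CommRing A] {φ : A →+* Γ(X, O)}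
    (h : IsLocalizingOn F O) (hF : FlatVia φ Γ(F, O)) (d : Γ(X, O)) :
    FlatVia ((resRing (X.basicOpen_le d)).comp φ) Γ(F, X.basicOpen d) := by
  let := basicOpenModule (F := F) d
  have := h.isLocalizedModule d
  exact hF.of_isLocalizedModule (.powers d) (resBasicOpen F d)

lemma IsLocalizingOn.flatVia_of_basicOpen {A : Type*} [CommRing A] {φ : A →+* Γ(X, O)}
    (hO : IsAffineOpen O) (h : IsLocalizingOn F O) (hF : ∀ x ∈ O, ∃ d : Γ(X, O), x ∈ X.basicOpen d ∧
      FlatVia ((resRing (X.basicOpen_le d)).comp φ) Γ(F, X.basicOpen d)) : FlatVia φ Γ(F, O) := by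
  let s : Set Γ(X, O) :=
    {d | FlatVia ((resRing (X.basicOpen_le d)).comp φ) Γ(F, X.basicOpen d)}
  have hs : Ideal.span s = ⊤ := span_eq_top_of_forall_exists_mem_basicOpen hO s fun x hx ↦ by
    obtain ⟨d, hd, hd'⟩ := hF x hx
    exact ⟨d, hd', hd⟩
  let (d : s) := basicOpenModule (F := F) d.1
  have (d : s) := h.isLocalizedModule d.1
  exact FlatVia.of_isLocalized_span s hs _ (fun d : s ↦ resBasicOpen F d.1) fun d ↦ d.2

end Basic

end SheafBimodule

namespace SheafBimodule

open TopologicalSpace Opposite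

/-! ### Coherence of the restriction to the support. -/

section Extension

variable {W P : Scheme.{u}} {i : W ⟶ P} [IsClosedImmersion i] {E : P.Modules}
  (hE : IsKilledBy i E)

/-- The ideal sheaf generated by the annihilators from below is contained in each of them, and this
inclusion is all that is needed. -/
lemma isKilledBy_schemeSupportι {P : Scheme.{u}} (E : P.Modules) :
    IsKilledBy (schemeSupportι E) E := by
  intro Q hQ c hc m
  have h1 : c ∈ (annihilatorIdeal E).ideal ⟨Q, hQ⟩ :=
    (Scheme.IdealSheafData.ker_subschemeι_app (annihilatorIdeal E) ⟨Q, hQ⟩).le hc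
  exact Module.mem_annihilator.mp
    (Scheme.IdealSheafData.ideal_ofIdeals_le (fun U ↦ Module.annihilator Γ(P, U.1) Γ(E, U.1))
      ⟨Q, hQ⟩ h1) m

/-- Sections of the restriction to `W` over the preimage of `Q` are sections of `E` over `Q`. -/
noncomputable def IsKilledBy.equiv {O : W.Opens} {Q : P.Opens} (h : i ⁻¹ᵁ Q = O) :
    Γ(hE.restrict, O) ≃+ Γ(E, Q) :=
  AddEquiv.ofBijective (res E ((le_extOpen i).mpr h.le) : Γ(E, extOpen i O) →+ Γ(E, Q))
    (hE.res_bijective _ ((preimage_extOpen i O).trans h.symm).le)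

lemma IsKilledBy.equiv_smul {O : W.Opens} {Q : P.Opens} (h : i ⁻¹ᵁ Q = O) (c : Γ(P, Q))
    (s : Γ(W, O)) (hc : i.app Q c = resRing h.le s) (m : Γ(hE.restrict, O)) :
    hE.equiv h (s • m) = c • hE.equiv h m :=
  hE.res_act s m _ hc

lemma IsKilledBy.equiv_res {O O' : W.Opens} {Q Q' : P.Opens} (h : i ⁻¹ᵁ Q = O)
    (h' : i ⁻¹ᵁ Q' = O') (hO : O' ≤ O) (hQ : Q' ≤ Q) (m : Γ(hE.restrict, O)) :
    hE.equiv h' (res hE.restrict hO m) = res E hQ (hE.equiv h m) :=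
  (res_res (E := E) ((le_extOpen i).mpr h'.le) (extOpen_mono i hO) m).trans
    (res_res (E := E) hQ ((le_extOpen i).mpr h.le) m).symm

/-- Every function on the preimage of the affine `Q` lifts to `Q`, so each basic open of the
preimage comes from one of `Q` and the property is inherited from `E`. -/
lemma IsKilledBy.isLocalizingOn_restrict {Q : P.Opens} (hQ : IsAffineOpen Q)
    (h : IsLocalizingOn E Q) : IsLocalizingOn hE.restrict (i ⁻¹ᵁ Q) := by
  have hlift (d : Γ(W, i ⁻¹ᵁ Q)) : ∃ c, i.app Q c = d := i.app_surjective Q hQ d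
  constructor
  · intro d t ht
    obtain ⟨c, rfl⟩ := hlift d
    have hD := i.preimage_basicOpen c
    have := hE.equiv_res rfl hD (W.basicOpen_le _) (P.basicOpen_le c) t
    rw [ht, map_zero] at this
    obtain ⟨n, hn⟩ := h.exists_pow_smul_eq_zero c _ this.symm
    refine ⟨n, (hE.equiv rfl).injective ?_⟩
    rw [hE.equiv_smul rfl (c ^ n) _ (by rw [map_pow, resRing_self]), hn, map_zero]
  · intro d s
    obtain ⟨c, rfl⟩ := hlift d
    have hD := i.preimage_basicOpen c
    obtain ⟨n, t, ht⟩ := h.exists_res_eq c (hE.equiv hD s)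
    refine ⟨n, (hE.equiv rfl).symm t, (hE.equiv hD).injective ?_⟩
    rw [hE.equiv_res rfl hD (W.basicOpen_le _) (P.basicOpen_le c), AddEquiv.apply_symm_apply, ht,
      hE.equiv_smul hD (resRing (P.basicOpen_le c) (c ^ n))]
    rw [app_resRing, resRing_resRing, map_pow]

lemma IsKilledBy.isQuasicoherent_restrict (h : SheafOfModules.IsQuasicoherent.{u} E) :
    SheafOfModules.IsQuasicoherent.{u} hE.restrict := by
  refine isQuasicoherent_of_isLocalizingOn fun w ↦ ?_
  obtain ⟨Q, hQ, hw, -⟩ :=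
    Opens.isBasis_iff_nbhd.mp P.isBasis_affineOpens (show i w ∈ (⊤ : P.Opens) from trivial)
  exact ⟨i ⁻¹ᵁ Q, hw, hQ.preimage i,
    hE.isLocalizingOn_restrict hQ (isLocalizingOn_of_isQuasicoherent hQ h)⟩

lemma IsKilledBy.finite_restrict_preimage {Q : P.Opens}
    [hfin : Module.Finite Γ(P, Q) Γ(E, Q)] :
    Module.Finite Γ(W, i ⁻¹ᵁ Q) Γ(hE.restrict, i ⁻¹ᵁ Q) := by
  let e := hE.equiv (i := i) (Q := Q) rfl
  have he (c : Γ(P, Q)) (m) : e (i.app Q c • m) = c • e m :=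
    hE.equiv_smul rfl c _ (by rw [resRing_self]) m
  obtain ⟨T, hT⟩ := hfin
  classical
  refine ⟨T.image e.symm, eq_top_iff.mpr fun m _ ↦ ?_⟩
  have key (x : Γ(E, Q)) (hx : x ∈ Submodule.span Γ(P, Q) (T : Set Γ(E, Q))) :
      e.symm x ∈ Submodule.span Γ(W, i ⁻¹ᵁ Q) (T.image e.symm : Set Γ(hE.restrict, i ⁻¹ᵁ Q)) := by
    induction hx using Submodule.span_induction with
    | mem x hx => exact Submodule.subset_span (by simpa using hx)
    | zero => simp
    | add x y _ _ hx hy => exact (map_add e.symm x y) ▸ add_mem hx hy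
    | smul a x _ hx =>
      have : e.symm (a • x) = i.app Q a • e.symm x := e.injective (by simp [he])
      exact this ▸ Submodule.smul_mem _ _ hx
  simpa using key (e m) (hT ▸ trivial)

lemma IsKilledBy.isCoherent_restrict (h : IsCoherent E) : IsCoherent hE.restrict where
  quasicoherent := hE.isQuasicoherent_restrict h.quasicoherent
  finite := by
    rintro ⟨O, hO⟩
    have hq := hE.isQuasicoherent_restrict h.quasicoherent
    refine (isLocalizingOn_of_isQuasicoherent hO hq).finite_of_basicOpen hO fun w hw ↦ ?_
    obtain ⟨Q, hQ, hwQ, -⟩ :=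
      Opens.isBasis_iff_nbhd.mp P.isBasis_affineOpens (show i w ∈ (⊤ : P.Opens) from trivial)
    obtain ⟨d, d', hdd', hd⟩ := exists_basicOpen_le_affine_inter hO (hQ.preimage i) w ⟨hw, hwQ⟩
    refine ⟨d, hd, ?_⟩
    rw [hdd']
    have := h.finite ⟨Q, hQ⟩
    have := hE.finite_restrict_preimage (Q := Q)
    exact (isLocalizingOn_of_isQuasicoherent (hQ.preimage i) hq).finite_basicOpen d'

end Extension

/-! ### Pushforwards computed on the support. -/

section Pushforward

variable {W P X : Scheme.{u}} {i : W ⟶ P} [IsClosedImmersion i] {E : P.Modules}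
  (hE : IsKilledBy i E) (p : P ⟶ X)

/-- Sections of the pushforward of `E` are sections of its restriction to `W`. -/
noncomputable def IsKilledBy.pushforwardEquiv (U : X.Opens) :
    Γ(hE.restrict, (i ≫ p) ⁻¹ᵁ U) ≃+ Γ((Scheme.Modules.pushforward p).obj E, U) :=
  hE.equiv (Q := p ⁻¹ᵁ U) rfl

lemma IsKilledBy.pushforwardEquiv_smul (U : X.Opens) (a : Γ(X, U))
    (m : Γ(hE.restrict, (i ≫ p) ⁻¹ᵁ U)) :
    hE.pushforwardEquiv p U ((i ≫ p).app U a • m) = a • hE.pushforwardEquiv p U m :=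
  hE.equiv_smul (Q := p ⁻¹ᵁ U) rfl (p.app U a) ((i ≫ p).app U a)
    ((congr($(Scheme.Hom.comp_app i p U) a)).symm.trans (resRing_self (P := W) le_rfl _).symm) m

lemma IsKilledBy.pushforwardEquiv_res {U V : X.Opens} (h : U ≤ V)
    (m : Γ(hE.restrict, (i ≫ p) ⁻¹ᵁ V)) :
    hE.pushforwardEquiv p U (res hE.restrict ((i ≫ p).preimage_mono h) m) =
      res ((Scheme.Modules.pushforward p).obj E) h (hE.pushforwardEquiv p V m) :=
  hE.equiv_res (Q := p ⁻¹ᵁ V) (Q' := p ⁻¹ᵁ U) rfl rfl ((i ≫ p).preimage_mono h)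
    (p.preimage_mono h) m

lemma IsKilledBy.isLocalizingOn_pushforward {V : X.Opens}
    (h : IsLocalizingOn hE.restrict ((i ≫ p) ⁻¹ᵁ V)) :
    IsLocalizingOn ((Scheme.Modules.pushforward p).obj E) V := by
  let g := i ≫ p
  let e (V : X.Opens) := hE.pushforwardEquiv p V
  have he (V : X.Opens) (a : Γ(X, V)) (m) : e V (g.app V a • m) = a • e V m :=
    hE.pushforwardEquiv_smul p V a m
  have hres {U V : X.Opens} (h : U ≤ V) (m) : e U (res hE.restrict (g.preimage_mono h) m) =
    res _ h (e V m) := hE.pushforwardEquiv_res p h m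
  have hD (d : Γ(X, V)) : W.basicOpen (g.app V d) = g ⁻¹ᵁ X.basicOpen d :=
    (g.preimage_basicOpen d).symm
  constructor
  · intro d t ht
    have h1 : res hE.restrict (W.basicOpen_le (g.app V d)) ((e V).symm t) = 0 := by
      rw [← (res_bijective_of_eq (E := hE.restrict) (hD d).ge (hD d).le).1.eq_iff, map_zero,
        res_res]
      apply (e _).injective
      rw [hres (X.basicOpen_le d), AddEquiv.apply_symm_apply, ht, map_zero]
    obtain ⟨n, hn⟩ := h.exists_pow_smul_eq_zero (g.app V d) _ h1
    refine ⟨n, ?_⟩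
    have h2 := he V (d ^ n) ((e V).symm t)
    rw [map_pow, hn, map_zero, AddEquiv.apply_symm_apply] at h2
    exact h2.symm
  · intro d s
    obtain ⟨n, t, ht⟩ := h.exists_res_eq (g.app V d) (res hE.restrict (hD d).le ((e _).symm s))
    refine ⟨n, e V t, ?_⟩
    rw [← hres (X.basicOpen_le d)]
    have h2 := congrArg (res hE.restrict (hD d).ge) ht
    rw [res_smul, res_res, res_res, res_self, resRing_resRing, ← map_pow] at h2
    rw [h2, ← app_resRing g (X.basicOpen_le d), he, AddEquiv.apply_symm_apply]

end Pushforward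

end SheafBimodule

namespace SheafBimodule

open TensorProduct

/-! ### Flat dimension through character modules; polynomial and étale extensions. -/

section FlatDimension

/-- The character module of `N`, as an object of the category of `B`-modules. -/
noncomputable abbrev charModule (B : Type u) [CommRing B] (N : Type u) [AddCommGroup N]
    [Module B N] : ModuleCat.{u} B :=
  ModuleCat.of B (CharacterModule N)

/-- `N` has flat dimension at most `d`, expressed as a bound on the injective dimension of its
character module. -/
def FlatDimLE (B : Type u) [CommRing B] (N : Type u) [AddCommGroup N] [Module B N] (d : ℕ) : Prop :=
  HasInjectiveDimensionLT (charModule B N) (d + 1)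

variable {B : Type u} [CommRing B] {N₁ N₂ N₃ : Type u} [AddCommGroup N₁] [AddCommGroup N₂]
  [AddCommGroup N₃] [Module B N₁] [Module B N₂] [Module B N₃]

lemma dual_exact (f : N₁ →ₗ[B] N₂) (g : N₂ →ₗ[B] N₃) (hfg : Function.Exact f g)
    (hg : Function.Surjective g) :
    Function.Exact (CharacterModule.dual g) (CharacterModule.dual f) := by
  intro c
  constructor
  · intro hc
    have hker : ∀ x, g x = 0 → c x = 0 := by
      intro x hx
      obtain ⟨y, rfl⟩ := (hfg x).mp hx
      exact DFunLike.congr_fun hc y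
    refine ⟨g.toAddMonoidHom.liftOfSurjective hg ⟨(c : N₂ →+ _), fun x hx ↦ hker x hx⟩, ?_⟩
    ext x
    exact g.toAddMonoidHom.liftOfRightInverse_comp_apply _ (Function.rightInverse_surjInv hg)
      ⟨(c : N₂ →+ _), fun x hx ↦ hker x hx⟩ x
  · rintro ⟨c, rfl⟩
    ext x
    change c (g (f x)) = 0
    rw [hfg.apply_apply_eq_zero, map_zero]

/-- The short complex of character modules. -/
noncomputable def dualComplex (f : N₁ →ₗ[B] N₂) (g : N₂ →ₗ[B] N₃) (hfg : Function.Exact f g) :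
    ShortComplex (ModuleCat.{u} B) where
  X₁ := charModule B N₃
  X₂ := charModule B N₂
  X₃ := charModule B N₁
  f := ModuleCat.ofHom (CharacterModule.dual g)
  g := ModuleCat.ofHom (CharacterModule.dual f)
  zero := by
    rw [← ModuleCat.ofHom_comp, ← CharacterModule.dual_comp, hfg.linearMap_comp_eq_zero,
      CharacterModule.dual_zero]
    rfl

lemma dualComplex_shortExact (f : N₁ →ₗ[B] N₂) (g : N₂ →ₗ[B] N₃) (hf : Function.Injective f)
    (hfg : Function.Exact f g) (hg : Function.Surjective g) :
    (dualComplex f g hfg).ShortExact where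
  exact := (ShortComplex.ShortExact.moduleCat_exact_iff_function_exact _).mpr
    (dual_exact f g hfg hg)
  mono_f := (ModuleCat.mono_iff_injective _).mpr (CharacterModule.dual_injective_of_surjective g hg)
  epi_g := (ModuleCat.epi_iff_surjective _).mpr (CharacterModule.dual_surjective_of_injective f hf)

variable (B) in
-- Lambek's theorem: a module is flat exactly when its character module is injective.
lemma flatDimLE_zero_iff : FlatDimLE B N₁ 0 ↔ Module.Flat B N₁ := by
  rw [Module.Flat.iff_characterModule_injective, Module.injective_iff_injective_object,
    injective_iff_hasInjectiveDimensionLT_one]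
  rfl

lemma FlatDimLE.mono {d e : ℕ} (h : FlatDimLE B N₁ d) (hde : d ≤ e) : FlatDimLE B N₁ e := by
  unfold FlatDimLE at *
  exact hasInjectiveDimensionLT_of_ge _ (d + 1) (e + 1) (by lia)

variable (B) in
lemma flatDimLE_of_flat [Module.Flat B N₁] (d : ℕ) : FlatDimLE B N₁ d :=
  ((flatDimLE_zero_iff B).mpr inferInstance).mono (Nat.zero_le d)

lemma FlatDimLE.succ_of_exact {d : ℕ} (f : N₁ →ₗ[B] N₂) (g : N₂ →ₗ[B] N₃)
    (hf : Function.Injective f) (hfg : Function.Exact f g) (hg : Function.Surjective g)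
    (h₁ : FlatDimLE B N₁ d) (h₂ : FlatDimLE B N₂ (d + 1)) : FlatDimLE B N₃ (d + 1) :=
  (dualComplex_shortExact f g hf hfg hg).hasInjectiveDimensionLT_X₁ (d + 1) h₁ h₂

lemma FlatDimLE.of_exact_of_flat {d : ℕ} (f : N₁ →ₗ[B] N₂) (g : N₂ →ₗ[B] N₃)
    (hf : Function.Injective f) (hfg : Function.Exact f g) (hg : Function.Surjective g)
    [Module.Flat B N₂] (h₃ : FlatDimLE B N₃ (d + 1)) : FlatDimLE B N₁ d :=
  (dualComplex_shortExact f g hf hfg hg).hasInjectiveDimensionLT_X₃ (d + 1)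
    (flatDimLE_of_flat B d) h₃

lemma FlatDimLE.of_retract {d : ℕ} (f : N₁ →ₗ[B] N₂) (g : N₂ →ₗ[B] N₁)
    (hgf : g.comp f = LinearMap.id) (h : FlatDimLE B N₂ d) : FlatDimLE B N₁ d := by
  let r : Retract (charModule B N₁) (charModule B N₂) :=
    { i := ModuleCat.ofHom (CharacterModule.dual g)
      r := ModuleCat.ofHom (CharacterModule.dual f)
      retract := by
        rw [← ModuleCat.ofHom_comp, ← CharacterModule.dual_comp, hgf]
        rfl }
  have : HasInjectiveDimensionLT (charModule B N₂) (d + 1) := h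
  exact r.hasInjectiveDimensionLT (d + 1)

lemma FlatDimLE.succ_baseChange_of_exact {P : Type u} [CommRing P] [Algebra P B] [Module.Flat P B]
    {d : ℕ} {K F N : Type u} [AddCommGroup K] [Module P K] [AddCommGroup F] [Module P F]
    [AddCommGroup N] [Module P N] (f : K →ₗ[P] F) (g : F →ₗ[P] N)
    (hf : Function.Injective f) (hfg : Function.Exact f g) (hg : Function.Surjective g)
    [Module.Flat P F] (h : FlatDimLE B (B ⊗[P] K) d) : FlatDimLE B (B ⊗[P] N) (d + 1) :=
  h.succ_of_exact (f.baseChange B) (g.baseChange B)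
    (Module.Flat.lTensor_preserves_injective_linearMap f hf) (lTensor_exact B hfg hg)
    (LinearMap.lTensor_surjective B hg) (flatDimLE_of_flat B _)

/-- Dimension shifting: the kernel of a free cover has flat dimension one less, and the cover stays
exact after the flat base change. -/
lemma FlatDimLE.baseChange {P : Type u} [CommRing P] [Algebra P B] [Module.Flat P B] {d : ℕ}
    (N : Type u) [AddCommGroup N] [Module P N] (h : FlatDimLE P N d) :
    FlatDimLE B (B ⊗[P] N) d := by
  induction d generalizing N with
  | zero =>
    have := (flatDimLE_zero_iff P).mp h
    exact flatDimLE_of_flat B 0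
  | succ d ih =>
    let g : (N →₀ P) →ₗ[P] N := Finsupp.linearCombination P id
    have hg : Function.Surjective g := Finsupp.linearCombination_id_surjective P N
    let f : LinearMap.ker g →ₗ[P] (N →₀ P) := (LinearMap.ker g).subtype
    have hf : Function.Injective f := Subtype.val_injective
    have hfg : Function.Exact f g := g.exact_subtype_ker_map
    exact FlatDimLE.succ_baseChange_of_exact (K := LinearMap.ker g) (F := N →₀ P) f g hf hfg hg
      (ih (LinearMap.ker g) (FlatDimLE.of_exact_of_flat f g hf hfg hg h))

/-- For an unramified extension the separability idempotent splits `B ⊗[P] N → N` over `B`, so `N`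
is a retract of its own base change. -/
lemma FlatDimLE.of_formallyUnramified {P : Type u} [CommRing P] [Algebra P B] [Module.Flat P B]
    [Algebra.FormallyUnramified P B] [Algebra.EssFiniteType P B] {d : ℕ}
    {N : Type u} [AddCommGroup N] [Module P N] [Module B N] [IsScalarTower P B N]
    (h : FlatDimLE P N d) : FlatDimLE B N d :=
  (h.baseChange (B := B)).of_retract _ _ (Algebra.FormallyUnramified.comp_sec P B N)

section Polynomial

open Polynomial

variable {P : Type u} [CommRing P] (N : Type u) [AddCommGroup N] [Module P N]

/-- The coefficients of an element of `P[X] ⊗ N`. -/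
noncomputable def tensorCoeff (i : ℕ) : P[X] ⊗[P] N →ₗ[P] N :=
  (TensorProduct.lid P N).toLinearMap.comp ((lcoeff P i).rTensor N)

@[simp]
lemma tensorCoeff_tmul (i : ℕ) (p : P[X]) (n : N) :
    tensorCoeff N i (p ⊗ₜ n) = p.coeff i • n := by
  simp [tensorCoeff]

lemma tensorCoeff_eq (i : ℕ) (z : P[X] ⊗[P] N) :
    tensorCoeff N i z = equivFinsuppOfBasisLeft (basisMonomials P) z i := by
  induction z with
  | zero => simp
  | add x y hx hy => simp [hx, hy]
  | tmul p n =>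
    rw [equivFinsuppOfBasisLeft_apply_tmul_apply, tensorCoeff_tmul]
    rfl

variable [Module P[X] N] [IsScalarTower P P[X] N]

/-- The endomorphism `X ⊗ 1 - 1 ⊗ X`. -/
noncomputable def polynomialRelation : P[X] ⊗[P] N →ₗ[P[X]] P[X] ⊗[P] N :=
  (X : P[X]) • LinearMap.id - LinearMap.baseChange P[X] (Algebra.lsmul P P N (X : P[X]))

lemma polynomialRelation_tmul (p : P[X]) (n : N) :
    polynomialRelation N (p ⊗ₜ[P] n) = (X * p) ⊗ₜ n - p ⊗ₜ ((X : P[X]) • n) := by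
  simp [polynomialRelation, TensorProduct.smul_tmul']

/-- The multiplication map. -/
noncomputable def polynomialAction : P[X] ⊗[P] N →ₗ[P[X]] N :=
  AlgebraTensorModule.lift
    (((Algebra.lsmul P[X] P[X] N).toLinearMap.flip.restrictScalars P).flip)

@[simp]
lemma polynomialAction_tmul (p : P[X]) (n : N) : polynomialAction N (p ⊗ₜ[P] n) = p • n := rfl

/-- Modulo the relations `X` moves across the tensor sign, so `Xⁱ ⊗ n` becomes `1 ⊗ Xⁱn` one factor
at a time. -/
lemma sub_tmul_mem_range_polynomialRelation (z : P[X] ⊗[P] N) :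
    z - (1 : P[X]) ⊗ₜ polynomialAction N z ∈ LinearMap.range (polynomialRelation N) := by
  induction z with
  | zero => simp
  | add x y hx hy =>
    have := add_mem hx hy
    rwa [← add_sub_add_comm, ← TensorProduct.tmul_add, ← map_add] at this
  | tmul p n =>
    induction p using Polynomial.induction_on' with
    | add p q hp hq =>
      have := add_mem hp hq
      rwa [← add_sub_add_comm, ← TensorProduct.tmul_add, ← map_add, ← TensorProduct.add_tmul] at this
    | monomial i a =>
      induction i generalizing n with
      | zero =>
        have : (monomial 0 a : P[X]) ⊗ₜ[P] n = (1 : P[X]) ⊗ₜ ((monomial 0 a : P[X]) • n) := by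
          rw [monomial_zero_left, ← Polynomial.algebraMap_eq, algebraMap_smul,
            ← TensorProduct.smul_tmul, Algebra.algebraMap_eq_smul_one]
        rw [polynomialAction_tmul, ← this, sub_self]
        exact zero_mem _
      | succ i ih =>
        have h1 : (monomial (i + 1) a : P[X]) = X * monomial i a := by
          rw [X_mul_monomial]
        have h2 : (monomial (i + 1) a : P[X]) ⊗ₜ[P] n -
            (1 : P[X]) ⊗ₜ polynomialAction N ((monomial (i + 1) a : P[X]) ⊗ₜ[P] n) =
          polynomialRelation N ((monomial i a : P[X]) ⊗ₜ[P] n) +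
            ((monomial i a : P[X]) ⊗ₜ[P] ((X : P[X]) • n) - (1 : P[X]) ⊗ₜ polynomialAction N
              ((monomial i a : P[X]) ⊗ₜ[P] ((X : P[X]) • n))) := by
          rw [polynomialRelation_tmul, polynomialAction_tmul, polynomialAction_tmul, h1, mul_comm X,
            mul_smul]
          abel
        rw [h2]
        exact add_mem ⟨_, rfl⟩ (ih _)

lemma tensorCoeff_succ_polynomialRelation (i : ℕ) (z : P[X] ⊗[P] N) :
    tensorCoeff N (i + 1) (polynomialRelation N z) =
      tensorCoeff N i z - (X : P[X]) • tensorCoeff N (i + 1) z := by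
  induction z with
  | zero => simp
  | add x y hx hy => simp only [map_add, hx, hy, smul_add]; abel
  | tmul p n =>
    rw [polynomialRelation_tmul, map_sub, tensorCoeff_tmul, tensorCoeff_tmul, tensorCoeff_tmul, tensorCoeff_tmul,
      coeff_X_mul, smul_comm]

/-- On the kernel each coefficient is `X` times the next one; as the coefficients eventually vanish,
all of them do. -/
lemma polynomialRelation_injective : Function.Injective (polynomialRelation (P := P) N) := by
  refine (injective_iff_map_eq_zero _).mpr fun z hz ↦ ?_
  have h1 (i : ℕ) : tensorCoeff N i z = (X : P[X]) • tensorCoeff N (i + 1) z := by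
    have := tensorCoeff_succ_polynomialRelation N i z
    rwa [hz, map_zero, eq_comm, sub_eq_zero] at this
  have h2 (i k : ℕ) : tensorCoeff N i z = (X : P[X]) ^ k • tensorCoeff N (i + k) z := by
    induction k with
    | zero => simp
    | succ k ih => rw [ih, h1 (i + k), smul_smul, ← pow_succ, add_assoc]
  apply (equivFinsuppOfBasisLeft (N := N) (basisMonomials P)).injective
  ext i
  obtain ⟨k, hk⟩ := (equivFinsuppOfBasisLeft (N := N) (basisMonomials P) z).support.exists_nat_subset_range
  rw [← tensorCoeff_eq, h2 i k, tensorCoeff_eq, Finsupp.notMem_support_iff.mp, smul_zero, map_zero,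
    Finsupp.zero_apply]
  intro h
  have := Finset.mem_range.mp (hk h)
  omega

lemma polynomialRelation_exact :
    Function.Exact (polynomialRelation (P := P) N) (polynomialAction N) := by
  intro z
  constructor
  · intro hz
    have := sub_tmul_mem_range_polynomialRelation N z
    rwa [hz, TensorProduct.tmul_zero, sub_zero] at this
  · rintro ⟨z, rfl⟩
    induction z with
    | zero => simp
    | add x y hx hy => rw [map_add, map_add, hx, hy, add_zero]
    | tmul p n =>
      rw [polynomialRelation_tmul, map_sub, polynomialAction_tmul, polynomialAction_tmul, smul_smul,
        mul_comm, sub_self]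

lemma polynomialAction_surjective : Function.Surjective (polynomialAction (P := P) N) :=
  fun n ↦ ⟨(1 : P[X]) ⊗ₜ n, by simp⟩

/-- The exact sequence `0 → P[X] ⊗ N → P[X] ⊗ N → N → 0` given by `X ⊗ 1 - 1 ⊗ X` costs one
dimension. -/
lemma FlatDimLE.polynomial {d : ℕ} (h : FlatDimLE P N d) : FlatDimLE P[X] N (d + 1) :=
  FlatDimLE.succ_of_exact _ _ (polynomialRelation_injective (P := P) N) (polynomialRelation_exact N)
    (polynomialAction_surjective N) (h.baseChange N) ((h.baseChange N).mono (Nat.le_succ d))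

end Polynomial

lemma flatDimLE_mvPolynomial (R : Type u) [CommRing R] (m : ℕ) :
    ∀ (N : Type u) [AddCommGroup N] [Module R N] [Module (MvPolynomial (Fin m) R) N]
      [IsScalarTower R (MvPolynomial (Fin m) R) N] [Module.Flat R N],
      FlatDimLE (MvPolynomial (Fin m) R) N m := by
  induction m with
  | zero =>
    intro N _ _ _ _ _
    have : Algebra.FormallyUnramified R (MvPolynomial (Fin 0) R) :=
      .of_surjective (Algebra.ofId _ _) (MvPolynomial.C_surjective (Fin 0))
    exact (flatDimLE_of_flat R 0).of_formallyUnramified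
  | succ m ih =>
    intro N _ _ _ _ _
    let P := MvPolynomial (Fin m) R
    let Q := MvPolynomial (Fin (m + 1)) R
    let e : Q ≃ₐ[R] Polynomial P := MvPolynomial.finSuccEquiv R m
    let _ : Module (Polynomial P) N := Module.compHom N (e.symm : Polynomial P →+* Q)
    let _ : Module P N := Module.compHom N (Polynomial.C : P →+* Polynomial P)
    have : IsScalarTower P (Polynomial P) N := .of_algebraMap_smul fun _ _ ↦ rfl
    have : IsScalarTower R P N := .of_algebraMap_smul fun r n ↦ by
      change e.symm (algebraMap R (Polynomial P) r) • n = r • n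
      rw [e.symm.commutes, algebraMap_smul]
    -- The isomorphism `P[X] ≃ Q` is treated as a flat unramified extension, so the bound crosses it
    -- by the same lemma as for étale maps.
    let _ : Algebra (Polynomial P) Q := (e.symm : Polynomial P →+* Q).toAlgebra
    have : IsScalarTower (Polynomial P) Q N := .of_algebraMap_smul fun _ _ ↦ rfl
    have hbij : Function.Bijective (algebraMap (Polynomial P) Q) := e.symm.bijective
    have : Algebra.FormallyUnramified (Polynomial P) Q :=
      .of_surjective (Algebra.ofId _ _) hbij.2
    have : Algebra.FiniteType (Polynomial P) Q := .of_surjective (Algebra.ofId _ _) hbij.2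
    have : Module.Flat (Polynomial P) Q :=
      .of_linearEquiv (LinearEquiv.ofBijective (Algebra.linearMap (Polynomial P) Q) hbij).symm
    exact (ih N).polynomial.of_formallyUnramified

lemma flatDimLE_of_formallyUnramified {R : Type u} [CommRing R] (m : ℕ)
    [Algebra (MvPolynomial (Fin m) R) B] [Module.Flat (MvPolynomial (Fin m) R) B]
    [Algebra.FormallyUnramified (MvPolynomial (Fin m) R) B]
    [Algebra.EssFiniteType (MvPolynomial (Fin m) R) B] (N : Type u) [AddCommGroup N] [Module B N]
    (h : FlatVia ((algebraMap (MvPolynomial (Fin m) R) B).comp MvPolynomial.C) N) :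
    FlatDimLE B N m := by
  let _ : Module (MvPolynomial (Fin m) R) N := Module.compHom N (algebraMap _ B)
  let _ : Module R N := Module.compHom N ((algebraMap (MvPolynomial (Fin m) R) B).comp MvPolynomial.C)
  have : Module.Flat R N := h
  have : IsScalarTower R (MvPolynomial (Fin m) R) N := .of_algebraMap_smul fun _ _ ↦ rfl
  have : IsScalarTower (MvPolynomial (Fin m) R) B N := .of_algebraMap_smul fun _ _ ↦ rfl
  exact (flatDimLE_mvPolynomial R m N).of_formallyUnramified

end FlatDimension

end SheafBimodule

namespace SheafBimodule

open TensorProduct Abelian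
open scoped Pointwise

/-! ### Vanishing of Ext into character modules. -/

section ExtVanishing

variable {B : Type u} [CommRing B]

/-- The vanishing of `Ext^i(K, N^*)`, where `N^*` is the character module of `N`. -/
def ExtVanish (K : ModuleCat.{u} B) (N : Type u) [AddCommGroup N] [Module B N] (i : ℕ) : Prop :=
  ∀ e : Ext K (charModule B N) i, e = 0

lemma FlatDimLE.extVanish {N : Type u} [AddCommGroup N] [Module B N] {d i : ℕ}
    (h : FlatDimLE B N d) (hi : d < i) (K : ModuleCat.{u} B) : ExtVanish K N i := fun e ↦
  have : HasInjectiveDimensionLT (charModule B N) (d + 1) := h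
  e.eq_zero_of_hasInjectiveDimensionLT (d + 1) hi

variable {D : Type u} [CommRing D] [Algebra B D]

/-- An element of `y` acts on Ext equally through either argument, and it acts as zero on `K`.
Linearity over `D` extends this to the ideal generated by `y`. -/
lemma comp_dual_lsmul_eq_zero {K : ModuleCat.{u} B} {y : Ideal B} (hK : ∀ b ∈ y, ∀ k : K, b • k = 0)
    (N : Type u) [AddCommGroup N] [Module B N] [Module D N] [IsScalarTower B D N] {i : ℕ}
    (e : Ext K (charModule B N) i) {x : D} (hx : x ∈ y.map (algebraMap B D)) :
    e.comp (Ext.mk₀ (Y := charModule B N)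
      (ModuleCat.ofHom (CharacterModule.dual (Algebra.lsmul B B N x)))) (add_zero i) = 0 := by
  induction hx using Submodule.span_induction with
  | mem x hx =>
    obtain ⟨b, hb, rfl⟩ := hx
    have h1 : ModuleCat.ofHom (CharacterModule.dual (Algebra.lsmul B B N (algebraMap B D b))) =
        b • 𝟙 (charModule B N) := by
      ext c n
      change c (algebraMap B D b • n) = c (b • n)
      rw [algebraMap_smul]
    have h2 : b • 𝟙 K = 0 := by
      ext k
      exact hK b hb k
    rw [h1, ← Ext.smul_eq_comp_mk₀, ← Ext.mk₀_id_comp e, ← Ext.smul_comp, ← Ext.mk₀_smul, h2,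
      Ext.mk₀_zero, Ext.zero_comp]
  | zero =>
    have h1 : ModuleCat.ofHom (CharacterModule.dual (Algebra.lsmul B B N (0 : D))) =
        (0 : charModule B N ⟶ charModule B N) := by
      rw [map_zero, CharacterModule.dual_zero]
      rfl
    rw [h1, Ext.mk₀_zero, Ext.comp_zero]
  | add x x' _ _ hx hx' =>
    have h1 : ModuleCat.ofHom (CharacterModule.dual (Algebra.lsmul B B N (x + x'))) =
        (ModuleCat.ofHom (CharacterModule.dual (Algebra.lsmul B B N x)) +
          ModuleCat.ofHom (CharacterModule.dual (Algebra.lsmul B B N x')) :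
          charModule B N ⟶ charModule B N) := by
      ext c n
      change c ((x + x') • n) = c (x • n) + c (x' • n)
      rw [add_smul, map_add]
    rw [h1, Ext.mk₀_add, Ext.comp_add, hx, hx', add_zero]
  | smul d x _ hx =>
    have h1 : ModuleCat.ofHom (CharacterModule.dual (Algebra.lsmul B B N (d • x))) =
        (ModuleCat.ofHom (CharacterModule.dual (Algebra.lsmul B B N x)) :
          charModule B N ⟶ charModule B N) ≫
          ModuleCat.ofHom (CharacterModule.dual (Algebra.lsmul B B N d)) := by
      ext c n
      change c ((d * x) • n) = c (x • d • n)
      rw [smul_smul, mul_comm]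
    rw [h1, ← Ext.mk₀_comp_mk₀, ← Ext.comp_assoc_of_third_deg_zero, hx, Ext.zero_comp]

lemma ExtVanish.of_exact {K : ModuleCat.{u} B} {N N' : Type u} [AddCommGroup N] [Module B N]
    [AddCommGroup N'] [Module B N'] (f : N →ₗ[B] N) (g : N →ₗ[B] N') (hf : Function.Injective f)
    (hfg : Function.Exact f g) (hg : Function.Surjective g) {i : ℕ}
    (hzero : ∀ e : Ext K (charModule B N) i, e.comp (Ext.mk₀ (Y := charModule B N)
      (ModuleCat.ofHom (CharacterModule.dual f))) (add_zero i) = 0)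
    (h : ExtVanish K N' (i + 1)) : ExtVanish K N i := by
  intro e
  obtain ⟨e', he'⟩ := Ext.covariant_sequence_exact₃ K (dualComplex_shortExact f g hf hfg hg)
    (n₀ := i) e rfl (h _)
  exact he'.symm.trans (hzero e')

lemma exact_lsmul_mkQ (N : Type u) [AddCommGroup N] [Module B N] [Module D N] [IsScalarTower B D N]
    (x : D) : Function.Exact (Algebra.lsmul B B N x)
      ((Submodule.mkQ (x • ⊤ : Submodule D N)).restrictScalars B) := by
  intro n
  rw [LinearMap.restrictScalars_apply, Submodule.mkQ_apply, Submodule.Quotient.mk_eq_zero,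
    Submodule.mem_smul_pointwise_iff_exists]
  simp only [Submodule.mem_top, true_and]
  rfl

/-- Multiplication by `x` is zero on `Ext^i(K, N^*)`, so the long exact sequence embeds this group
into `Ext^{i+1}(K, (N/xN)^*)`. This is the degree shift that drives the proof. -/
lemma ExtVanish.of_quotSMulTop {K : ModuleCat.{u} B} {y : Ideal B}
    (hK : ∀ b ∈ y, ∀ k : K, b • k = 0)
    {N : Type u} [AddCommGroup N] [Module B N] [Module D N] [IsScalarTower B D N] {i : ℕ}
    {x : D} (hx : x ∈ y.map (algebraMap B D)) (hreg : IsSMulRegular N x)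
    (h : ExtVanish K (QuotSMulTop x N) (i + 1)) : ExtVanish K N i := by
  let g : N →ₗ[B] QuotSMulTop x N := (Submodule.mkQ (x • ⊤ : Submodule D N)).restrictScalars B
  have hg : Function.Surjective g := Submodule.mkQ_surjective (x • ⊤ : Submodule D N)
  have hf : Function.Injective (Algebra.lsmul B B N x) := hreg
  have hfg : Function.Exact (Algebra.lsmul B B N x) g := exact_lsmul_mkQ N x
  have hz (e : Ext K (charModule B N) i) := comp_dual_lsmul_eq_zero hK N e hx
  exact ExtVanish.of_exact (Algebra.lsmul B B N x) g hf hfg hg hz h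

end ExtVanishing

/-! ### Flatness of quotients by monic polynomials. -/

section Monic

open Polynomial

lemma FlatVia.comp_flat {A A' C N : Type*} [CommRing A] [CommRing A'] [CommRing C]
    [AddCommGroup N] [Module C N] {φ : A →+* C} (h : FlatVia φ N) (ψ : A' →+* A) (hψ : ψ.Flat) :
    FlatVia (φ.comp ψ) N := by
  algebraize [ψ]
  let _ : Module A N := Module.compHom N φ
  let _ : Module A' N := Module.compHom N (φ.comp ψ)
  have : IsScalarTower A' A N := .of_algebraMap_smul fun _ _ ↦ rfl
  have : Module.Flat A N := h
  exact Module.Flat.trans A' A N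

/-- `A[X]/(f)` is free over `A`, and `N/fN` is the flat base change of `N` to it. -/
lemma flat_quotSMulTop_of_monic {A N : Type u} [CommRing A] [AddCommGroup N] [Module A N]
    [Module A[X] N] [IsScalarTower A A[X] N] [Module.Flat A[X] N] {f : A[X]} (hf : f.Monic) :
    Module.Flat A (QuotSMulTop f N) := by
  have := hf.free_quotient
  have : Module.Flat A ((A[X] ⧸ Ideal.span {f}) ⊗[A[X]] N) :=
    Module.Flat.trans A (A[X] ⧸ Ideal.span {f}) _
  exact Module.Flat.of_linearEquiv ((QuotSMulTop.equivQuotTensor f N).restrictScalars A)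

lemma flatVia_quotSMulTop_of_monic {A D N : Type u} [CommRing A] [CommRing D] [AddCommGroup N]
    [Module D N] {φ : A[X] →+* D} (h : FlatVia φ N) {f : A[X]} (hf : f.Monic) :
    IsSMulRegular N (φ f) ∧ FlatVia (φ.comp C) (QuotSMulTop (φ f) N) := by
  algebraize [φ]
  let _ : Module A[X] N := Module.compHom N φ
  let _ : Module A N := Module.compHom N (φ.comp C)
  have : IsScalarTower A A[X] N := .of_algebraMap_smul fun _ _ ↦ rfl
  have : IsScalarTower A[X] D N := .of_algebraMap_smul fun _ _ ↦ rfl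
  have : Module.Flat A[X] N := h
  refine ⟨(Module.Flat.isSMulRegular_of_isRegular hf.isRegular : IsSMulRegular N f), ?_⟩
  have h1 := flat_quotSMulTop_of_monic (N := N) hf
  let p : Submodule D N := φ f • ⊤
  have hp : (f • ⊤ : Submodule A[X] N) = p.restrictScalars A[X] := by
    ext n
    simp only [p, Submodule.mem_smul_pointwise_iff_exists, Submodule.restrictScalars_mem]
    rfl
  let e : QuotSMulTop f N ≃ₗ[A[X]] QuotSMulTop (φ f) N :=
    (Submodule.quotEquivOfEq _ _ hp).trans (Submodule.Quotient.restrictScalarsEquiv A[X] p)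
  have h2 : FlatVia (algebraMap A A[X]) (QuotSMulTop f N) := flatVia_algebraMap.mpr h1
  exact h2.of_equiv e.toAddEquiv fun a m ↦ e.map_smul (C a) m

end Monic

/-! ### Trading polynomial variables for Ext degrees. -/

section Machine

open Polynomial

variable {B D R : Type u} [CommRing B] [CommRing D] [CommRing R] [Algebra B D] [Algebra R D]

/-- Induction on `n`: dividing by `f(t₀)` removes one variable and raises the Ext degree by one,
until only flatness over `R` is left and `H` applies. The sum `i + n` stays constant. -/
lemma extVanish_of_flatVia_aeval {K : ModuleCat.{u} B} {y : Ideal B}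
    (hK : ∀ b ∈ y, ∀ k : K, b • k = 0) {m : ℕ}
    (H : ∀ (N : Type u) [AddCommGroup N] [Module B N] [Module D N] [IsScalarTower B D N] (i : ℕ),
      FlatVia (algebraMap R D) N → m < i → ExtVanish K N i)
    (n : ℕ) (t : Fin n → D)
    (ht : ∀ j, ∃ f : R[X], f.Monic ∧ aeval (t j) f ∈ y.map (algebraMap B D)) :
    ∀ (N : Type u) [AddCommGroup N] [Module B N] [Module D N] [IsScalarTower B D N] (i : ℕ),
      FlatVia (MvPolynomial.aeval (R := R) t).toRingHom N → m < i + n → ExtVanish K N i := by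
  induction n with
  | zero =>
    intro N _ _ _ _ i hN hi
    refine H N i ?_ hi
    have := hN.comp_flat (MvPolynomial.C : R →+* MvPolynomial (Fin 0) R)
      (RingHom.flat_algebraMap_iff.mpr inferInstance)
    convert this
    ext r
    simp
  | succ n ih =>
    intro N _ _ _ _ i hN hi
    obtain ⟨f, hf, hx⟩ := ht 0
    let e := MvPolynomial.finSuccEquiv R n
    let A := MvPolynomial (Fin n) R
    let φ : A[X] →+* D := (MvPolynomial.aeval (R := R) t).toRingHom.comp (e.symm : A[X] →+* _)
    have hN' : FlatVia φ N := hN.comp_flat _ (RingHom.Flat.of_bijective e.symm.bijective)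
    have hφX : φ X = t 0 := by
      have : e (MvPolynomial.X 0) = X := MvPolynomial.finSuccEquiv_X_zero
      change MvPolynomial.aeval t (e.symm X) = t 0
      rw [← this, e.symm_apply_apply, MvPolynomial.aeval_X]
    have hφC : φ.comp C = (MvPolynomial.aeval (R := R) (t ∘ Fin.succ)).toRingHom := by
      refine MvPolynomial.ringHom_ext (fun r ↦ ?_) fun j ↦ ?_
      · change MvPolynomial.aeval t (e.symm (algebraMap R A[X] r)) = _
        rw [e.symm.commutes]
        simp
      · have : e (MvPolynomial.X j.succ) = C (MvPolynomial.X j) :=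
          MvPolynomial.finSuccEquiv_X_succ
        change MvPolynomial.aeval t (e.symm (C (MvPolynomial.X j))) = _
        rw [← this, e.symm_apply_apply, MvPolynomial.aeval_X]
        simp
    -- The polynomial has coefficients in `R`; it is viewed over the ring `A` of remaining variables
    -- so that it stays monic there.
    have hφf : φ (f.map (algebraMap R A)) = aeval (t 0) f := by
      have : (φ.comp (mapRingHom (algebraMap R A))) = (aeval (R := R) (t 0)).toRingHom := by
        refine Polynomial.ringHom_ext (fun r ↦ ?_) ?_
        · have := congr($hφC (algebraMap R A r))
          refine .trans ?_ (this.trans ?_)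
          · simp
          · exact (AlgHom.commutes (MvPolynomial.aeval (t ∘ Fin.succ)) r).trans (by simp)
        · simpa using hφX
      exact congr($this f)
    obtain ⟨hreg, hflat⟩ := flatVia_quotSMulTop_of_monic hN' (hf.map (algebraMap R A))
    rw [hφf] at hreg hflat
    rw [hφC] at hflat
    exact ExtVanish.of_quotSMulTop hK hx hreg
      (ih (t ∘ Fin.succ) (fun j ↦ ht j.succ) _ (i + 1) hflat (by lia))

end Machine

end SheafBimodule

namespace SheafBimodule

open TensorProduct Abelian

/-! ### The local criterion of flatness in terms of Ext. -/

section LocalCriterion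

variable {B : Type u} [CommRing B]

/-- `Hom(-, N^*)` is the character dual of `N ⊗ -`, so injectivity after tensoring means that maps
`L → N^*` extend to `F`; the obstruction lies in `Ext¹(K, N^*)`. -/
lemma lTensor_injective_of_extVanish {N K L F : Type u} [AddCommGroup N] [Module B N]
    [AddCommGroup K] [Module B K] [AddCommGroup L] [Module B L] [AddCommGroup F] [Module B F]
    (f : L →ₗ[B] F) (g : F →ₗ[B] K) (hf : Function.Injective f) (hfg : Function.Exact f g)
    (hg : Function.Surjective g) (h : ExtVanish (ModuleCat.of B K) N 1) :
    Function.Injective (f.lTensor N) := by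
  rw [LinearMap.lTensor_inj_iff_rTensor_inj, rTensor_injective_iff_lcomp_surjective]
  intro c
  let S : ShortComplex (ModuleCat.{u} B) :=
    .mk (ModuleCat.ofHom f) (ModuleCat.ofHom g) (by
      rw [← ModuleCat.ofHom_comp, hfg.linearMap_comp_eq_zero]
      rfl)
  have hS : S.ShortExact :=
    { exact := (ShortComplex.ShortExact.moduleCat_exact_iff_function_exact _).mpr hfg
      mono_f := (ModuleCat.mono_iff_injective _).mpr hf
      epi_g := (ModuleCat.epi_iff_surjective _).mpr hg }
  let c' : S.X₁ ⟶ charModule B N := ModuleCat.ofHom c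
  obtain ⟨x, hx⟩ := Ext.contravariant_sequence_exact₁ hS _ (Ext.mk₀ c') rfl (h _)
  obtain ⟨d, rfl⟩ := (Ext.mk₀_bijective _ _).2 x
  rw [Ext.mk₀_comp_mk₀] at hx
  have := (Ext.mk₀_bijective _ _).1 hx
  exact ⟨d.hom, congr($(this).hom)⟩

/-- Dévissage by prime quotients `B/p`: each such `p` contains a power of the maximal ideal `y`,
hence equals `y`. Modules isomorphic to `B/y` are allowed in the hypothesis because the induction
produces them only up to isomorphism. -/
lemma ExtVanish.of_pow_smul_eq_zero [IsNoetherianRing B] {y : Ideal B} (hy : y.IsMaximal)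
    {N : Type u} [AddCommGroup N] [Module B N] {i : ℕ}
    (h : ∀ (K : Type u) [AddCommGroup K] [Module B K], (K ≃ₗ[B] B ⧸ y) →
      ExtVanish (ModuleCat.of B K) N i) (n : ℕ)
    (L : Type u) [AddCommGroup L] [Module B L] [hL : Module.Finite B L]
    (hn : ∀ b ∈ y ^ n, ∀ l : L, b • l = 0) : ExtVanish (ModuleCat.of B L) N i := by
  induction hL using IsNoetherianRing.induction_on_isQuotientEquivQuotientPrime B with
  | subsingleton L =>
    have : IsZero (ModuleCat.of B L) := ModuleCat.isZero_of_subsingleton _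
    intro e
    rw [← Ext.mk₀_id_comp e, this.eq_of_src (𝟙 _) 0, Ext.mk₀_zero, Ext.zero_comp]
  | quotient L p e =>
    have hyp : y ≤ p.1 := by
      refine p.2.le_of_pow_le (n := n) fun b hb ↦ ?_
      have := hn b hb (e.symm 1)
      rw [← map_smul, e.symm.map_eq_zero_iff, Algebra.smul_def, mul_one] at this
      exact Ideal.Quotient.eq_zero_iff_mem.mp this
    obtain rfl := hy.eq_of_le p.2.ne_top hyp
    exact h L e
  | exact L₁ L₂ L₃ f g hf hg hfg h₁ h₃ =>
    have h₁' := h₁ fun b hb l ↦ hf (by rw [map_smul, hn b hb, map_zero])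
    have h₃' := h₃ fun b hb l ↦ by
      obtain ⟨l, rfl⟩ := hg l
      rw [← map_smul, hn b hb, map_zero]
    let S : ShortComplex (ModuleCat.{u} B) :=
      .mk (ModuleCat.ofHom f) (ModuleCat.ofHom g) (by
        rw [← ModuleCat.ofHom_comp, hfg.linearMap_comp_eq_zero]
        rfl)
    have hS : S.ShortExact :=
      { exact := (ShortComplex.ShortExact.moduleCat_exact_iff_function_exact _).mpr hfg
        mono_f := (ModuleCat.mono_iff_injective _).mpr hf
        epi_g := (ModuleCat.epi_iff_surjective _).mpr hg }
    intro e
    obtain ⟨e₃, rfl⟩ := Ext.contravariant_sequence_exact₂ hS _ e (h₁' _)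
    exact (congr((Ext.mk₀ S.g).comp $(h₃' e₃) (zero_add i))).trans (Ext.comp_zero _ _ _ _ _)

variable {D : Type u} [CommRing D] [Algebra B D]

lemma tmul_mem_map_pow_smul {y : Ideal B} (j : ℕ) (I : Ideal B) {N : Type u} [AddCommGroup N]
    [Module B N] [Module D N] [IsScalarTower B D N] {z : B} (hz : z ∈ y ^ j • I) (hzI : z ∈ I)
    (v : N) : v ⊗ₜ[B] (⟨z, hzI⟩ : I) ∈
      ((y.map (algebraMap B D)) ^ j • ⊤ : Submodule D (N ⊗[B] I)) := by
  induction hz using Submodule.smul_induction_on' with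
  | smul b hb c hc =>
    have : v ⊗ₜ[B] (⟨b • c, hzI⟩ : I) = algebraMap B D b • v ⊗ₜ[B] (⟨c, hc⟩ : I) := by
      rw [algebraMap_smul, ← TensorProduct.tmul_smul]
      rfl
    rw [this, ← Ideal.map_pow]
    exact Submodule.smul_mem_smul (Ideal.mem_map_of_mem _ hb) trivial
  | add a ha b hb h h' =>
    have hle : y ^ j • I ≤ I := Submodule.smul_le_right
    have := add_mem (h (hle ha)) (h' (hle hb))
    rwa [← TensorProduct.tmul_add] at this

/-- Since `I/(I ∩ p) ≃ (I + p)/p`, the quotient map of `I` factors through `I + p`, where `u`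
already dies; right exactness then lifts `u` to `N ⊗ (I ∩ p)`. -/
lemma mem_range_lTensor_of_sup {I p : Ideal B} {N : Type u} [AddCommGroup N] [Module B N]
    (hinj : Function.Injective ((I ⊔ p : Ideal B).subtype.lTensor N)) {u : N ⊗[B] I}
    (hu : I.subtype.lTensor N u = 0) :
    u ∈ LinearMap.range ((Submodule.comap I.subtype p).subtype.lTensor N) := by
  let ι : I →ₗ[B] (I ⊔ p : Ideal B) := Submodule.inclusion le_sup_left
  have hι : ι.lTensor N u = 0 := hinj <| by
    rw [map_zero, ← LinearMap.comp_apply, ← LinearMap.lTensor_comp]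
    exact hu
  let q : I →ₗ[B] I ⧸ Submodule.comap I.subtype p := Submodule.mkQ _
  have hle : Submodule.comap I.subtype p = Submodule.comap I.subtype I ⊓ Submodule.comap I.subtype p := by
    ext x
    simp
  let e := (Submodule.quotEquivOfEq _ _ hle).trans (LinearMap.quotientInfEquivSupQuotient I p)
  have hq : q = (e.symm.toLinearMap.comp (Submodule.mkQ _)).comp ι := by
    ext x
    exact (e.symm_apply_apply (q x)).symm
  have hu' : q.lTensor N u = 0 := by
    rw [hq, LinearMap.lTensor_comp, LinearMap.comp_apply, hι, map_zero]
  exact (lTensor_exact N (LinearMap.exact_subtype_mkQ _) (Submodule.mkQ_surjective _) u).mp hu'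

lemma finite_tensorProduct_left (I N : Type u) [AddCommGroup I] [Module B I] [Module.Finite B I]
    [AddCommGroup N] [Module B N] [Module D N] [IsScalarTower B D N] [Module.Finite D N] :
    Module.Finite D (N ⊗[B] I) :=
  .equiv (AlgebraTensorModule.cancelBaseChange B D D N I)

/-- The local flatness criterion. -/
lemma flat_of_extVanish_quotient [IsNoetherianRing B] [IsNoetherianRing D] {y : Ideal B}
    (hy : y.IsMaximal) (hyD : y.map (algebraMap B D) ≤ Ideal.jacobson ⊥)
    {N : Type u} [AddCommGroup N] [Module B N] [Module D N] [IsScalarTower B D N]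
    [Module.Finite D N]
    (h : ∀ (K : Type u) [AddCommGroup K] [Module B K], (K ≃ₗ[B] B ⧸ y) →
      ExtVanish (ModuleCat.of B K) N 1) : Module.Flat B N := by
  rw [Module.Flat.iff_lTensor_injective']
  intro I
  have hinj (n : ℕ) : Function.Injective ((I ⊔ y ^ n : Ideal B).subtype.lTensor N) := by
    refine lTensor_injective_of_extVanish _ _ Subtype.val_injective
      (LinearMap.exact_subtype_mkQ _) (Submodule.mkQ_surjective _)
      (ExtVanish.of_pow_smul_eq_zero hy h n _ fun b hb l ↦ ?_)
    obtain ⟨l, rfl⟩ := Submodule.mkQ_surjective _ l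
    rw [← map_smul, Submodule.mkQ_apply, Submodule.Quotient.mk_eq_zero, smul_eq_mul]
    exact Ideal.mul_mem_right _ _ (le_sup_right (a := I) hb)
  refine (injective_iff_map_eq_zero _).mpr fun u hu ↦ ?_
  have : Module.Finite D (N ⊗[B] I) := finite_tensorProduct_left I N
  -- Krull's intersection theorem for the finite `D`-module `N ⊗ I`: it suffices to place `u` in
  -- every power of `yD`.
  have hbot := (y.map (algebraMap B D)).iInf_pow_smul_eq_bot_of_le_jacobson (M := N ⊗[B] I) hyD
  rw [← Submodule.mem_bot D, ← hbot, Submodule.mem_iInf]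
  intro j
  -- Artin–Rees: `y^(j+k) ∩ I` lies in `y^j I`, so membership in `N ⊗ (I ∩ y^(j+k))` gives
  -- divisibility by the `j`-th power.
  obtain ⟨k, hk⟩ := y.exists_pow_inf_eq_pow_smul I
  obtain ⟨v, rfl⟩ := mem_range_lTensor_of_sup (hinj (j + k)) hu
  clear hu
  induction v with
  | zero => rw [map_zero]; exact zero_mem _
  | add v w hv hw => rw [map_add]; exact add_mem hv hw
  | tmul v z =>
    refine tmul_mem_map_pow_smul j I (z := z.1.1) ?_ z.1.2 v
    have h1 : z.1.1 ∈ y ^ (j + k) • (⊤ : Ideal B) ⊓ I :=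
      ⟨by rw [smul_eq_mul, Ideal.mul_top]; exact z.2, z.1.2⟩
    rw [hk _ (Nat.le_add_left k j), Nat.add_sub_cancel] at h1
    exact Submodule.smul_mono le_rfl inf_le_right h1

end LocalCriterion

end SheafBimodule

namespace SheafBimodule

open TensorProduct Abelian IsLocalRing

/-! ### The flatness transfer for rings. -/

section Core

-- By Zariski's lemma the residue field of `D = C_w` is finite over that of `R'`; an integral
-- equation of the residue class of `t` lifts to a monic polynomial over `R'`.
open Polynomial in
lemma exists_monic_aeval_mem_maximalIdeal {R R' C : Type u} [CommRing R] [CommRing R'] [CommRing C]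
    [IsLocalRing R'] [Algebra R C] [Algebra.FiniteType R C] [Algebra R R'] (w : Ideal C)
    [w.IsMaximal] [Algebra R' (Localization.AtPrime w)]
    [IsScalarTower R R' (Localization.AtPrime w)]
    [IsLocalHom (algebraMap R' (Localization.AtPrime w))] (t : Localization.AtPrime w) :
    ∃ f : R'[X], f.Monic ∧ aeval t f ∈ maximalIdeal (Localization.AtPrime w) := by
  have : Module.Finite C w.ResidueField := inferInstance
  have : Algebra.FiniteType R w.ResidueField := .trans (S := C) inferInstance inferInstance
  have : Algebra.FiniteType (ResidueField R') (ResidueField (Localization.AtPrime w)) :=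
    .of_restrictScalars_finiteType R _ _
  have : Module.Finite (ResidueField R') (ResidueField (Localization.AtPrime w)) :=
    finite_of_finite_type_of_isJacobsonRing _ _
  obtain ⟨g, hg, hg'⟩ := Algebra.IsIntegral.isIntegral (R := ResidueField R') (residue _ t)
  obtain ⟨f, hf, -, hf'⟩ := lifts_and_natDegree_eq_and_monic
    (map_surjective (residue R') residue_surjective g) hg
  refine ⟨f, hf', ?_⟩
  rw [← residue_eq_zero_iff, ← hg', ← hf, eval₂_map, aeval_def, hom_eval₂]
  rfl

/-- A prime containing the extended ideal lies over the same prime of `B` as the maximal ideal does;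
there are no strict inclusions within a quasi-finite fibre, so it is the maximal ideal. -/
lemma radical_map_maximalIdeal {B C : Type u} [CommRing B] [CommRing C] [Algebra B C]
    [Algebra.QuasiFinite B C] (w : Ideal C) [w.IsPrime] {B' : Type u} [CommRing B'] [IsLocalRing B']
    [Algebra B B'] [Algebra B' (Localization.AtPrime w)] [IsScalarTower B B' (Localization.AtPrime w)]
    [IsLocalHom (algebraMap B' (Localization.AtPrime w))] :
    ((maximalIdeal B').map (algebraMap B' (Localization.AtPrime w))).radical =
      maximalIdeal (Localization.AtPrime w) := by
  refine le_antisymm ?_ ?_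
  · refine (maximalIdeal.isMaximal _).isPrime.radical_le_iff.mpr ?_
    exact ((local_hom_TFAE (algebraMap B' (Localization.AtPrime w))).out 0 2).mp ‹_›
  · rw [Ideal.radical_eq_sInf]
    refine le_sInf fun q ⟨hq, hqp⟩ ↦ ?_
    refine (Algebra.QuasiFinite.eq_of_le_of_under_eq (R := B) q _ (le_maximalIdeal hqp.ne_top) ?_).ge
    have h1 : q.under B' = maximalIdeal B' :=
      ((maximalIdeal.isMaximal B').eq_of_le (hqp.comap _).ne_top (Ideal.map_le_iff_le_comap.mp hq)).symm
    have h2 : (maximalIdeal (Localization.AtPrime w)).under B' = maximalIdeal B' :=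
      ((local_hom_TFAE (algebraMap B' (Localization.AtPrime w))).out 0 4).mp ‹_›
    rw [← Ideal.under_under (B := B') q, ← Ideal.under_under (B := B') (maximalIdeal _), h1, h2]

/-- `R'[t₁, …, tₙ]` is a localization of `R[t₁, …, tₙ]`, and for a module over the localization the
two flatness conditions agree. -/
lemma flatVia_aeval_of_isLocalization {R R' D : Type u} [CommRing R] [CommRing R'] [CommRing D]
    [Algebra R R'] [Algebra R D] [Algebra R' D] [IsScalarTower R R' D] (p : Submonoid R)
    [IsLocalization p R'] {n : ℕ} (t : Fin n → D) {N : Type u} [AddCommGroup N] [Module D N]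
    (h : FlatVia (MvPolynomial.aeval (R := R) t).toRingHom N) :
    FlatVia (MvPolynomial.aeval (R := R') t).toRingHom N := by
  let P := MvPolynomial (Fin n) R
  let P' := MvPolynomial (Fin n) R'
  let _ : Algebra P P' := MvPolynomial.algebraMvPolynomial
  let _ : Module P N := Module.compHom N (MvPolynomial.aeval (R := R) t).toRingHom
  let _ : Module P' N := Module.compHom N (MvPolynomial.aeval (R := R') t).toRingHom
  have : IsScalarTower P P' N := .of_algebraMap_smul fun a x ↦ by
    change MvPolynomial.aeval (R := R') t (MvPolynomial.map (algebraMap R R') a) • x =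
      MvPolynomial.aeval t a • x
    rw [MvPolynomial.aeval_map_algebraMap]
  exact (Module.flat_iff_of_isLocalization P' (p.map (MvPolynomial.C (σ := Fin n))) N).mpr h

/-- The local version of the main algebraic result. -/
lemma flat_of_flatVia_aeval_of_isLocalRing {R R' B D N : Type u} [CommRing R] [CommRing R']
    [CommRing B] [CommRing D] [IsNoetherianRing B] [IsLocalRing B] [IsNoetherianRing D]
    [IsLocalRing D] [Algebra R R'] [Algebra R B] [Algebra R D] [Algebra R' D] [Algebra B D]
    [IsScalarTower R R' D] [IsScalarTower R B D] [IsLocalHom (algebraMap B D)] (p : Submonoid R)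
    [IsLocalization p R'] {m n : ℕ} [Algebra (MvPolynomial (Fin m) R) B]
    [IsScalarTower R (MvPolynomial (Fin m) R) B]
    [Module.Flat (MvPolynomial (Fin m) R) B] [Algebra.FormallyUnramified (MvPolynomial (Fin m) R) B]
    [Algebra.EssFiniteType (MvPolynomial (Fin m) R) B]
    [AddCommGroup N] [Module B N] [Module D N] [IsScalarTower B D N] [Module.Finite D N]
    (hmn : m ≤ n) (t : Fin n → D)
    (hrad : ((maximalIdeal B).map (algebraMap B D)).radical = maximalIdeal D)
    (ht : ∀ j, ∃ f : Polynomial R', f.Monic ∧ Polynomial.aeval (t j) f ∈ maximalIdeal D)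
    (h : FlatVia (MvPolynomial.aeval (R := R) t).toRingHom N) : Module.Flat B N := by
  have hle : (maximalIdeal B).map (algebraMap B D) ≤ maximalIdeal D :=
    hrad ▸ Ideal.le_radical
  refine flat_of_extVanish_quotient (D := D) (maximalIdeal.isMaximal B)
    (hle.trans (maximalIdeal_le_jacobson _)) fun K _ _ e ↦ ?_
  refine extVanish_of_flatVia_aeval (R := R') (D := D) (y := maximalIdeal B) (m := m) ?_ ?_ n t ?_ N 1
    (flatVia_aeval_of_isLocalization p t h) (by lia)
  · intro b hb k
    refine e.injective ?_
    rw [map_smul, map_zero]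
    obtain ⟨c, hc⟩ := Ideal.Quotient.mk_surjective (e k)
    rw [← hc]
    exact Ideal.Quotient.eq_zero_iff_mem.mpr (Ideal.mul_mem_right _ _ hb)
  · intro N _ _ _ _ i hN hi
    refine FlatDimLE.extVanish (d := m) (flatDimLE_of_formallyUnramified (R := R) m N ?_) hi _
    have : Module.Flat R R' := IsLocalization.flat R' p
    have h1 := hN.comp_flat (algebraMap R R') (RingHom.flat_algebraMap_iff.mpr inferInstance)
    rw [← IsScalarTower.algebraMap_eq] at h1
    have h2 : (algebraMap (MvPolynomial (Fin m) R) B).comp MvPolynomial.C = algebraMap R B :=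
      (IsScalarTower.algebraMap_eq R (MvPolynomial (Fin m) R) B).symm
    rw [h2]
    exact h1.of_equiv (AddEquiv.refl N) fun a x ↦ by
      change algebraMap R D a • x = algebraMap R B a • x
      rw [IsScalarTower.algebraMap_apply R B D, algebraMap_smul]
  · intro j
    obtain ⟨f, hf, hf'⟩ := ht j
    rw [← hrad] at hf'
    obtain ⟨k, hk⟩ := hf'
    -- `f(t_j)` lies only in the radical of the extended ideal; a power of the still monic `f` moves
    -- it into the ideal itself.
    exact ⟨f ^ k, hf.pow k, by rwa [map_pow]⟩

/-- Let `M` be a finite module over a finite type `R`-algebra `C` which is quasi-finite over an étale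
`R[u₁, …, u_m]`-algebra `B`. If `M` is flat over `R[t₁, …, t_n]` for some `t₁, …, t_n` in `C` with
`m ≤ n`, then `M` is flat over `B`. -/
lemma flat_of_flatVia_aeval {R B C M : Type u} [CommRing R] [CommRing B] [CommRing C]
    [IsNoetherianRing B] [IsNoetherianRing C] [Algebra R B] [Algebra R C] [Algebra B C]
    [IsScalarTower R B C] [Algebra.FiniteType R C] [Algebra.QuasiFinite B C]
    {m n : ℕ} [Algebra (MvPolynomial (Fin m) R) B]
    [IsScalarTower R (MvPolynomial (Fin m) R) B] [Algebra.Etale (MvPolynomial (Fin m) R) B]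
    [AddCommGroup M] [Module B M] [Module C M] [IsScalarTower B C M] [Module.Finite C M]
    (hmn : m ≤ n) (t : Fin n → C)
    (h : FlatVia (MvPolynomial.aeval (R := R) t).toRingHom M) : Module.Flat B M := by
  refine Module.flat_of_isLocalized_maximal (S := C) (M := M)
    (fun w _ ↦ LocalizedModule w.primeCompl M) (fun w _ ↦ LocalizedModule.mkLinearMap _ _)
    fun w hw ↦ ?_
  let P := MvPolynomial (Fin m) R
  let D := Localization.AtPrime w
  let N := LocalizedModule w.primeCompl M
  let y := w.comap (algebraMap B C)
  let s := w.comap (algebraMap R C)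
  let B' := Localization.AtPrime y
  let R' := Localization.AtPrime s
  let _ : Algebra B' D := (Localization.localRingHom y w (algebraMap B C) rfl).toAlgebra
  let _ : Algebra R' D := (Localization.localRingHom s w (algebraMap R C) rfl).toAlgebra
  have : IsScalarTower B B' D := .of_algebraMap_eq fun b ↦
    (Localization.localRingHom_to_map y w (algebraMap B C) rfl b).symm
  have : IsScalarTower R R' D := .of_algebraMap_eq fun b ↦
    (Localization.localRingHom_to_map s w (algebraMap R C) rfl b).symm
  have : IsLocalHom (algebraMap B' D) := Localization.isLocalHom_localRingHom y w _ rfl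
  have : IsLocalHom (algebraMap R' D) := Localization.isLocalHom_localRingHom s w _ rfl
  have : IsScalarTower R B' D := .of_algebraMap_eq fun r ↦ by
    rw [IsScalarTower.algebraMap_apply R B B', ← IsScalarTower.algebraMap_apply B B' D,
      ← IsScalarTower.algebraMap_apply R B D]
  have : Module.Flat P B := inferInstance
  have : Module.Flat B B' := IsLocalization.flat B' y.primeCompl
  have : Module.Flat P B' := .trans P B B'
  have : Algebra.FormallyUnramified B B' := .of_isLocalization y.primeCompl
  have : Algebra.FormallyUnramified P B' := .comp P B B'
  have : Algebra.EssFiniteType B B' := .of_isLocalization B' y.primeCompl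
  have : Algebra.EssFiniteType P B' := .comp P B B'
  let _ : Module B' N := Module.compHom N (algebraMap B' D)
  have : IsScalarTower B' D N := .of_algebraMap_smul fun _ _ ↦ rfl
  have : IsScalarTower B B' N := .of_algebraMap_smul fun b x ↦ by
    rw [← algebraMap_smul D (algebraMap B B' b), ← IsScalarTower.algebraMap_apply, algebraMap_smul]
  have : Module.Flat B' N := by
    refine flat_of_flatVia_aeval_of_isLocalRing (R := R) (R' := R') (D := D) s.primeCompl (m := m) hmn
      (fun j ↦ algebraMap C D (t j)) (radical_map_maximalIdeal (B := B) w)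
      (fun j ↦ exists_monic_aeval_mem_maximalIdeal (R := R) w _) ?_
    have h1 := h.of_isLocalizedModule w.primeCompl (LocalizedModule.mkLinearMap w.primeCompl M)
    refine h1.of_equiv (AddEquiv.refl N) fun a x ↦ ?_
    change MvPolynomial.aeval t a • x = MvPolynomial.aeval (fun j ↦ algebraMap C D (t j)) a • x
    rw [← algebraMap_smul D (MvPolynomial.aeval t a), ← MvPolynomial.aeval_algebraMap_apply]
    rfl
  exact Module.Flat.trans B B' N

end Core

end SheafBimodule

namespace SheafBimodule

/-! ### Dimension of standard smooth algebras and of topological spaces. -/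

section Dimension

lemma height_eq_of_isMaximal_mvPolynomial {k : Type u} [Field k] (m : ℕ)
    (q : Ideal (MvPolynomial (Fin m) k)) [hq : q.IsMaximal] : q.height = m := by
  induction m with
  | zero =>
    have h := Ideal.height_le_ringKrullDim_of_ne_top hq.ne_top
    rw [MvPolynomial.ringKrullDim_of_isNoetherianRing, ringKrullDim_eq_zero_of_field] at h
    simpa using h
  | succ m ih =>
    let e := (MvPolynomial.finSuccEquiv k m).toRingEquiv
    let q' : Ideal (Polynomial (MvPolynomial (Fin m) k)) := q.map e
    have : q'.IsMaximal := Ideal.map_isMaximal_of_equiv e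
    have : (q'.under (MvPolynomial (Fin m) k)).IsMaximal :=
      Polynomial.isMaximal_comap_C_of_isJacobsonRing q'
    have : q'.LiesOver (q'.under (MvPolynomial (Fin m) k)) := ⟨rfl⟩
    have h := Polynomial.height_eq_height_add_one (q'.under (MvPolynomial (Fin m) k)) q'
    rw [ih, e.height_map] at h
    rw [h]
    rfl

lemma isMaximal_under_of_finiteType {P D : Type*} [CommRing P] [CommRing D] [Algebra P D]
    [IsJacobsonRing P] [Algebra.FiniteType P D] (q : Ideal D) [hq : q.IsMaximal] :
    (q.under P).IsMaximal := by
  let _ : Field (D ⧸ q) := Ideal.Quotient.field q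
  have : Module.Finite P (D ⧸ q) := finite_of_finite_type_of_isJacobsonRing _ _
  have h := Ideal.isMaximal_comap_of_isIntegral_of_isMaximal' (algebraMap P (D ⧸ q))
    (algebraMap_isIntegral_iff.mpr inferInstance) ⊥
  convert h
  rw [IsScalarTower.algebraMap_eq P D (D ⧸ q), ← Ideal.comap_comap]
  congr 1
  rw [Ideal.Quotient.algebraMap_eq, ← RingHom.ker_eq_comap_bot, Ideal.mk_ker]

/-- `D` is étale over `k[u₁, …, u_m]`. Quasi-finite fibres keep chains of primes strict, which
bounds the dimension above; going down over a maximal ideal, of height `m`, bounds it below. -/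
lemma ringKrullDim_eq_of_isStandardSmoothOfRelativeDimension {k D : Type u} [Field k] [CommRing D]
    [Nontrivial D] [Algebra k D] (m : ℕ) [Algebra.IsStandardSmoothOfRelativeDimension m k D] :
    ringKrullDim D = m := by
  obtain ⟨g, hg⟩ := Algebra.IsStandardSmoothOfRelativeDimension.exists_etale_mvPolynomial k D (n := m)
  let _ : Algebra (MvPolynomial (Fin m) k) D := g.toAlgebra
  have : Algebra.Etale (MvPolynomial (Fin m) k) D := hg
  have hm : ringKrullDim (MvPolynomial (Fin m) k) = m := by
    simp [ringKrullDim_eq_zero_of_field]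
  refine le_antisymm ?_ ?_
  · rw [← hm]
    refine Order.krullDim_le_of_strictMono (PrimeSpectrum.comap (algebraMap _ _)) fun p q hpq ↦ ?_
    refine lt_of_le_of_ne (Ideal.comap_mono hpq.le) fun h ↦ hpq.ne (PrimeSpectrum.ext ?_)
    exact Algebra.QuasiFinite.eq_of_le_of_under_eq (R := MvPolynomial (Fin m) k) _ _ hpq.le
      congr(($h).asIdeal)
  · obtain ⟨q, hq⟩ := Ideal.exists_maximal D
    have : IsNoetherianRing D := Algebra.FiniteType.isNoetherianRing (MvPolynomial (Fin m) k) D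
    have : (q.under (MvPolynomial (Fin m) k)).IsMaximal :=
      isMaximal_under_of_finiteType q
    have h := Ideal.height_eq_height_add_of_liesOver_of_hasGoingDown
      (q.under (MvPolynomial (Fin m) k)) q
    rw [height_eq_of_isMaximal_mvPolynomial] at h
    refine le_trans ?_ (Ideal.height_le_ringKrullDim_of_ne_top hq.ne_top)
    rw [h]
    exact_mod_cast le_self_add

lemma eq_of_isStandardSmoothOfRelativeDimension {R D : Type u} [CommRing R] [CommRing D]
    [Nontrivial D] {φ : R →+* D} {m n : ℕ} (hm : φ.IsStandardSmoothOfRelativeDimension m)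
    (hn : φ.IsStandardSmoothOfRelativeDimension n) : m = n := by
  let _ : Algebra R D := φ.toAlgebra
  have : Algebra.IsStandardSmoothOfRelativeDimension m R D := hm
  have : Algebra.IsStandardSmoothOfRelativeDimension n R D := hn
  have h1 := Algebra.IsStandardSmoothOfRelativeDimension.rank_kaehlerDifferential (R := R) (S := D) m
  have h2 := Algebra.IsStandardSmoothOfRelativeDimension.rank_kaehlerDifferential (R := R) (S := D) n
  exact_mod_cast h1.symm.trans h2

open TopologicalSpace

variable {X : Type*} [TopologicalSpace X]

lemma isIrreducible_preimage_subtypeVal {Z s : Set X} (hs : IsIrreducible s) (hsZ : s ⊆ Z) :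
    IsIrreducible (Subtype.val ⁻¹' s : Set Z) := by
  obtain ⟨x, hx⟩ := hs.nonempty
  refine ⟨⟨⟨x, hsZ hx⟩, hx⟩, ?_⟩
  rintro _ _ ⟨u, hu, rfl⟩ ⟨v, hv, rfl⟩ ⟨x, hx, hxu⟩ ⟨y, hy, hyv⟩
  obtain ⟨z, hz, hzu, hzv⟩ := hs.isPreirreducible u v hu hv ⟨x, hx, hxu⟩ ⟨y, hy, hyv⟩
  exact ⟨⟨z, hsZ hz⟩, hz, hzu, hzv⟩

lemma exists_mem_irreducibleComponents_le_topologicalKrullDim {n : ℕ}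
    (h : n ≤ topologicalKrullDim X) :
    ∃ Z ∈ irreducibleComponents X, n ≤ topologicalKrullDim Z := by
  obtain ⟨l, hl⟩ := Order.le_krullDim_iff.mp h
  obtain ⟨Z, hZ, hle⟩ := exists_mem_irreducibleComponents_subset_of_isIrreducible
    (l.last : Set X) l.last.isIrreducible
  have hlZ (i : Fin (l.length + 1)) : (l i : Set X) ⊆ Z :=
    subset_trans (SetLike.coe_subset_coe.mpr (l.monotone (Fin.le_last i))) hle
  let c (i : Fin (l.length + 1)) : IrreducibleCloseds Z :=
    ⟨Subtype.val ⁻¹' (l i : Set X), isIrreducible_preimage_subtypeVal (l i).isIrreducible (hlZ i),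
      (l i).isClosed.preimage continuous_subtype_val⟩
  have hc (i : Fin l.length) : c i.castSucc < c i.succ := by
    have hlt : l i.castSucc < l i.succ := l.step i
    have hle : c i.castSucc ≤ c i.succ := fun x hx ↦ hlt.le (show x.1 ∈ l i.castSucc from hx)
    refine lt_of_le_not_ge hle fun h ↦ hlt.not_ge fun x hx ↦ ?_
    exact h (show (⟨x, hlZ _ hx⟩ : Z) ∈ c i.succ from hx)
  exact ⟨Z, hZ, Order.le_krullDim_iff.mpr ⟨⟨l.length, c, hc⟩, hl⟩⟩

/-- Take `z` in the smallest member of a chain of length `n`: every open neighbourhood of `z` meets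
all members, so the whole chain restricts to it. -/
lemma exists_forall_isOpen_le_topologicalKrullDim {n : ℕ} {Z : Set X}
    (h : n ≤ topologicalKrullDim Z) :
    ∃ z ∈ Z, ∀ W : Set X, IsOpen W → z ∈ W → n ≤ topologicalKrullDim W := by
  obtain ⟨l, hl⟩ := Order.le_krullDim_iff.mp h
  obtain ⟨z, hz⟩ := l.head.isIrreducible.nonempty
  let l' := l.map _ (IrreducibleCloseds.map_strictMono_of_isInducing
    (Topology.IsInducing.subtypeVal (t := Z)))
  refine ⟨z, z.2, fun W hW hzW ↦ Order.le_krullDim_iff.mpr ?_⟩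
  let e := IrreducibleCloseds.orderIsoOfIsOpenEmbedding _ hW.isOpenEmbedding_subtypeVal
  have hzl (i : Fin (l'.length + 1)) : ((↑) ⁻¹' (l' i : Set X) : Set W).Nonempty := by
    refine ⟨⟨z, hzW⟩, subset_closure ⟨z, ?_, rfl⟩⟩
    exact l.monotone (Fin.zero_le i) hz
  exact ⟨⟨l'.length, fun i ↦ e.symm ⟨l' i, hzl _⟩, fun i ↦ e.symm.strictMono (l'.step i)⟩, hl⟩

end Dimension

end SheafBimodule

namespace SheafBimodule

open RingHom

/-! ### The relative dimension of smooth charts is the fibre dimension. -/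

section Charts

variable {X S : Scheme.{u}} (α : X ⟶ S)

/-- The morphism `α` is standard smooth of relative dimension `m` on suitable affine neighbourhoods
of `x` and `α x`. -/
def HasRelativeDimensionAt (x : X) (m : ℕ) : Prop :=
  ∃ (V : S.Opens) (_ : IsAffineOpen V) (U : X.Opens) (_ : IsAffineOpen U) (_ : x ∈ U)
    (e : U ≤ α ⁻¹ᵁ V), (α.appLE V U e).hom.IsStandardSmoothOfRelativeDimension m

lemma exists_hasRelativeDimensionAt [Smooth α] (x : X) : ∃ m, HasRelativeDimensionAt α x m := by
  obtain ⟨V, hV, U, hU, hx, e, h⟩ := Smooth.exists_isStandardSmooth α x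
  let _ := (α.appLE V U e).hom.toAlgebra
  have h' : Algebra.IsStandardSmooth Γ(S, V) Γ(X, U) := h
  obtain ⟨ι, σ, hσ, hι, ⟨P⟩⟩ := h'.out
  exact ⟨P.dimension, V, hV, U, hU, hx, e, ⟨ι, σ, hσ, hι, P, rfl⟩⟩

variable {α}

lemma HasRelativeDimensionAt.exists_of_mem {x : X} {m : ℕ} (h : HasRelativeDimensionAt α x m)
    {V : S.Opens} (hV : IsAffineOpen V) (hxV : α x ∈ V) {U : X.Opens} (hxU : x ∈ U) :
    ∃ (W : X.Opens) (_ : IsAffineOpen W) (_ : x ∈ W) (_ : W ≤ U) (e : W ≤ α ⁻¹ᵁ V),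
      (α.appLE V W e).hom.IsStandardSmoothOfRelativeDimension m := by
  obtain ⟨V₂, hV₂, U₂, hU₂, hx₂, e₂, h₂⟩ := h
  obtain ⟨_, ⟨U₁, hU₁, rfl⟩, hxU₁, hle⟩ :=
    X.isBasis_affineOpens.exists_subset_of_mem_open (show x ∈ (U : Set X) from hxU) U.2
  obtain ⟨r, s, hx₁, e₁, h₁⟩ := exists_basicOpen_le_appLE_of_appLE_of_isAffine
    (isStandardSmoothOfRelativeDimension_stableUnderCompositionWithLocalizationAway m).right
    (isStandardSmoothOfRelativeDimension_localizationPreserves m).away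
    x ⟨V, hV⟩ ⟨V₂, hV₂⟩ ⟨U₁, hU₁⟩ ⟨U₂, hU₂⟩ hxU₁ hx₂ e₂ h₂ hxV
  refine ⟨X.basicOpen s, hU₁.basicOpen s, hx₁, (X.basicOpen_le s).trans hle,
    e₁.trans (α.preimage_mono (S.basicOpen_le r)), ?_⟩
  have heq : α.appLE V (X.basicOpen s) (e₁.trans (α.preimage_mono (S.basicOpen_le r))) =
      CommRingCat.ofHom (algebraMap Γ(S, V) Γ(S, S.basicOpen r)) ≫
        α.appLE (S.basicOpen r) (X.basicOpen s) e₁ := by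
    rw [RingHom.algebraMap_toAlgebra, CommRingCat.ofHom_hom, α.map_appLE]
  rw [heq]
  have : IsLocalization.Away r Γ(S, S.basicOpen r) := hV.isLocalization_basicOpen r
  exact (isStandardSmoothOfRelativeDimension_stableUnderCompositionWithLocalizationAway m).left
    _ r _ h₁

lemma appLE_basicOpen_isStandardSmoothOfRelativeDimension {V : S.Opens} {U : X.Opens}
    (hU : IsAffineOpen U) {e : U ≤ α ⁻¹ᵁ V} {m : ℕ}
    (h : (α.appLE V U e).hom.IsStandardSmoothOfRelativeDimension m) (r : Γ(X, U)) {W : X.Opens}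
    (hW : W = X.basicOpen r) (e' : W ≤ α ⁻¹ᵁ V) :
    (α.appLE V W e').hom.IsStandardSmoothOfRelativeDimension m := by
  subst hW
  have heq : α.appLE V (X.basicOpen r) e' =
      α.appLE V U e ≫ CommRingCat.ofHom (algebraMap Γ(X, U) Γ(X, X.basicOpen r)) := by
    rw [RingHom.algebraMap_toAlgebra, CommRingCat.ofHom_hom, α.appLE_map]
  rw [heq]
  have : IsLocalization.Away r Γ(X, X.basicOpen r) := hU.isLocalization_basicOpen r
  exact (isStandardSmoothOfRelativeDimension_stableUnderCompositionWithLocalizationAway m).right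
    _ r _ h

lemma HasRelativeDimensionAt.eq {x : X} {m n : ℕ} (hm : HasRelativeDimensionAt α x m)
    (hn : HasRelativeDimensionAt α x n) : m = n := by
  obtain ⟨V, hV, U, hU, hx, e, h⟩ := hm
  obtain ⟨U', hU', hx', hle, e', h'⟩ := hn.exists_of_mem hV (e hx) hx
  obtain ⟨r, s, hrs, hxr⟩ := exists_basicOpen_le_affine_inter hU hU' x ⟨hx, hx'⟩
  have hle := (X.basicOpen_le r).trans e
  have : Nonempty (X.basicOpen r) := ⟨⟨x, hxr⟩⟩
  exact eq_of_isStandardSmoothOfRelativeDimension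
    (appLE_basicOpen_isStandardSmoothOfRelativeDimension hU h r rfl hle)
    (appLE_basicOpen_isStandardSmoothOfRelativeDimension hU' h' s hrs hle)

lemma isStandardSmoothOfRelativeDimension_ι_comp_iff {U V : X.Opens} (hVU : V ≤ U) {W : S.Opens}
    {m : ℕ} (e : V ≤ α ⁻¹ᵁ W) :
    ((U.ι ≫ α).appLE W (U.ι ⁻¹ᵁ V) (by
      rw [Scheme.Hom.comp_preimage]
      exact U.ι.preimage_mono e)).hom.IsStandardSmoothOfRelativeDimension m ↔
    (α.appLE W V e).hom.IsStandardSmoothOfRelativeDimension m := by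
  have : IsIso (U.ι.app V) := U.ι.isIso_app V (by simpa using hVU)
  rw [← Scheme.Hom.appLE_comp_appLE U.ι α W V _ e le_rfl, U.ι.appLE_eq_app]
  exact isStandardSmoothOfRelativeDimension_respectsIso.cancel_right_isIso _ _

lemma hasRelativeDimensionAt_ι_comp_iff {U : X.Opens} (y : U) (m : ℕ) :
    HasRelativeDimensionAt (U.ι ≫ α) y m ↔ HasRelativeDimensionAt α y m := by
  constructor
  · rintro ⟨W, hW, V, hV, hy, e, h⟩
    obtain ⟨V', hV', hle, rfl⟩ : ∃ V' : X.Opens, IsAffineOpen V' ∧ V' ≤ U ∧ V = U.ι ⁻¹ᵁ V' :=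
      ⟨U.ι ''ᵁ V, hV.image_of_isOpenImmersion _, U.ι_image_le V, (U.ι.preimage_image_eq V).symm⟩
    have e' : V' ≤ α ⁻¹ᵁ W := fun x hx ↦ e (show (⟨x, hle hx⟩ : U) ∈ U.ι ⁻¹ᵁ V' from hx)
    exact ⟨W, hW, V', hV', hy, e', (isStandardSmoothOfRelativeDimension_ι_comp_iff hle e').mp h⟩
  · intro h
    obtain ⟨W, hW, _, _, hy, e, _⟩ := id h
    obtain ⟨V, hV, hyV, hle, e, h⟩ := h.exists_of_mem hW (e hy) y.2
    exact ⟨W, hW, U.ι ⁻¹ᵁ V, hV.preimage_of_isOpenImmersion _ (by simpa using hle), hyV, _,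
      (isStandardSmoothOfRelativeDimension_ι_comp_iff hle e).mpr h⟩

lemma topologicalKrullDim_eq_of_isAffineOpen {U : X.Opens} (hU : IsAffineOpen U) :
    topologicalKrullDim U = ringKrullDim Γ(X, U) := by
  rw [← PrimeSpectrum.topologicalKrullDim_eq_ringKrullDim]
  exact IsHomeomorph.topologicalKrullDim_eq _ (Scheme.homeoOfIso hU.isoSpec).isHomeomorph

lemma HasRelativeDimensionAt.exists_topologicalKrullDim_eq {k : CommRingCat.{u}} (hk : IsField k)
    {π : X ⟶ Spec k} {x : X} {m : ℕ} (h : HasRelativeDimensionAt π x m) :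
    ∃ W : X.Opens, x ∈ W ∧ (∀ y ∈ W, HasRelativeDimensionAt π y m) ∧ topologicalKrullDim W = m := by
  obtain ⟨W, hW, hx, -, e, h⟩ := h.exists_of_mem (isAffineOpen_top _) trivial (U := ⊤) trivial
  refine ⟨W, hx, fun y hy ↦ ⟨⊤, isAffineOpen_top _, W, hW, hy, e, h⟩, ?_⟩
  rw [topologicalKrullDim_eq_of_isAffineOpen hW]
  have hf : IsField Γ(Spec k, ⊤) :=
    (Scheme.ΓSpecIso k).commRingCatIsoToRingEquiv.toMulEquiv.isField hk
  let _ := hf.toField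
  have : Nonempty W := ⟨⟨x, hx⟩⟩
  let _ := (π.appLE ⊤ W e).hom.toAlgebra
  have : Algebra.IsStandardSmoothOfRelativeDimension m Γ(Spec k, ⊤) Γ(X, W) := h
  exact ringKrullDim_eq_of_isStandardSmoothOfRelativeDimension (k := Γ(Spec k, ⊤)) m

/-- A chart at `x` has dimension `m`, which cannot exceed that of all components. Conversely, a long
chain in the component of `x` may live near another point `z`, but the charts at `x` and `z` meet on
that irreducible component, so their dimensions agree. -/
lemma HasRelativeDimensionAt.eq_of_forall_topologicalKrullDim_eq {k : CommRingCat.{u}} (hk : IsField k)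
    {π : X ⟶ Spec k} [Smooth π] {x : X} {m n : ℕ} (h : HasRelativeDimensionAt π x m)
    (hdim : ∀ Z ∈ irreducibleComponents X, topologicalKrullDim Z = n) : m = n := by
  obtain ⟨W, hx, hW, hWm⟩ := h.exists_topologicalKrullDim_eq hk
  refine le_antisymm ?_ ?_
  · obtain ⟨Z, hZ, hle⟩ := exists_mem_irreducibleComponents_le_topologicalKrullDim (X := X) (n := m)
      (hWm.ge.trans (topologicalKrullDim_subspace_le X W))
    rw [hdim Z hZ] at hle
    exact_mod_cast hle
  · have hZ := irreducibleComponent_mem_irreducibleComponents x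
    obtain ⟨z, hz, hdimz⟩ := exists_forall_isOpen_le_topologicalKrullDim (hdim _ hZ).ge
    obtain ⟨m', hm'⟩ := exists_hasRelativeDimensionAt π z
    obtain ⟨W', hzW', hW', hWm'⟩ := hm'.exists_topologicalKrullDim_eq hk
    have hle := hdimz W' W'.2 hzW'
    obtain ⟨y, -, hy, hy'⟩ := isIrreducible_irreducibleComponent.isPreirreducible W W' W.2 W'.2
      ⟨x, mem_irreducibleComponent, hx⟩ ⟨z, hz, hzW'⟩
    obtain rfl := (hW y hy).eq (hW' y hy')
    have : (n : WithBot ℕ∞) ≤ m := hle.trans hWm'.le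
    exact_mod_cast this

/-- On a small open the relative dimension is constantly `m`, a condition stable under base change
to the fibre through `x`; there the question is one over a field. -/
lemma HasRelativeDimensionAt.eq_of_isSmoothEquidimensional {x : X} {m n : ℕ}
    (h : HasRelativeDimensionAt α x m) (hα : IsSmoothEquidimensional α n) : m = n := by
  obtain ⟨W, hW, U, hU, hx, e, h⟩ := h
  have : Smooth α := hα.smooth
  have h1 : SmoothOfRelativeDimension m (U.ι ≫ α) :=
    ⟨fun y ↦ (hasRelativeDimensionAt_ι_comp_iff y m).mpr ⟨W, hW, U, hU, y.2, e, h⟩⟩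
  let j := α.fiberι (α x)
  let π := α.fiberToSpecResidueField (α x)
  have h2 : IsPullback j π α (S.fromSpecResidueField (α x)) := .of_hasPullback _ _
  have : Smooth π := MorphismProperty.of_isPullback h2 inferInstance
  have h3 := (isPullback_morphismRestrict j U).paste_vert h2
  have := smoothOfRelativeDimension_isStableUnderBaseChange m
  have h4 : SmoothOfRelativeDimension m ((j ⁻¹ᵁ U).ι ≫ π) :=
    MorphismProperty.of_isPullback (P := @SmoothOfRelativeDimension m) h3 h1
  let z : (j ⁻¹ᵁ U : (α.fiber (α x)).Opens) := ⟨α.asFiber x, by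
    change j (α.asFiber x) ∈ U
    rwa [α.fiberι_asFiber]⟩
  have h5 : HasRelativeDimensionAt π (α.asFiber x) m :=
    (hasRelativeDimensionAt_ι_comp_iff z m).mp
      (h4.exists_isStandardSmoothOfRelativeDimension z)
  exact h5.eq_of_forall_topologicalKrullDim_eq (Field.toIsField (S.residueField (α x))) (hα.dim_eq (α x))

end Charts

end SheafBimodule

namespace SheafBimodule

/-! ### Transfer of flatness from one side to the other. -/

section Transfer

lemma flatVia_of_isStandardSmoothOfRelativeDimension {R A B C M : Type u} [CommRing R] [CommRing A]
    [CommRing B] [CommRing C] [IsNoetherianRing B] [IsNoetherianRing C] [AddCommGroup M]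
    [Module C M] [Module.Finite C M] {a : R →+* A} {b : R →+* B} {p : A →+* C} {q : B →+* C}
    (hpq : p.comp a = q.comp b) {m : ℕ} (ha : a.IsStandardSmoothOfRelativeDimension m)
    (hb : b.IsStandardSmoothOfRelativeDimension m) (hfin : (p.comp a).FiniteType)
    (hq : q.QuasiFinite) (h : FlatVia p M) : FlatVia q M := by
  let _ : Algebra R A := a.toAlgebra
  let _ : Algebra R B := b.toAlgebra
  let _ : Algebra B C := q.toAlgebra
  let _ : Algebra R C := (p.comp a).toAlgebra
  have : IsScalarTower R B C := .of_algebraMap_eq' hpq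
  have : Algebra.IsStandardSmoothOfRelativeDimension m R A := ha
  have : Algebra.IsStandardSmoothOfRelativeDimension m R B := hb
  have : Algebra.FiniteType R C := hfin
  have : Algebra.QuasiFinite B C := hq
  obtain ⟨g, hg⟩ := Algebra.IsStandardSmoothOfRelativeDimension.exists_etale_mvPolynomial R A (n := m)
  obtain ⟨g', hg'⟩ := Algebra.IsStandardSmoothOfRelativeDimension.exists_etale_mvPolynomial R B (n := m)
  let _ : Algebra (MvPolynomial (Fin m) R) B := g'.toAlgebra
  have : IsScalarTower R (MvPolynomial (Fin m) R) B := .of_algebraMap_eq' g'.comp_algebraMap.symm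
  have : Algebra.Etale (MvPolynomial (Fin m) R) B := hg'
  let _ : Algebra (MvPolynomial (Fin m) R) A := g.toAlgebra
  have : Algebra.Etale (MvPolynomial (Fin m) R) A := hg
  have hflat : (g : MvPolynomial (Fin m) R →+* A).Flat :=
    (inferInstance : Module.Flat (MvPolynomial (Fin m) R) A)
  let _ : Module B M := Module.compHom M q
  have : IsScalarTower B C M := .of_algebraMap_smul fun _ _ ↦ rfl
  have h1 := h.comp_flat _ hflat
  have h2 : p.comp (g : MvPolynomial (Fin m) R →+* A) =
      (MvPolynomial.aeval (R := R) fun j ↦ p (g (MvPolynomial.X j))).toRingHom := by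
    refine MvPolynomial.ringHom_ext (fun r ↦ ?_) fun j ↦ ?_
    · change p (g (algebraMap R _ r)) = MvPolynomial.aeval _ (algebraMap R _ r)
      rw [g.commutes, AlgHom.commutes]
      rfl
    · change p (g (MvPolynomial.X j)) = MvPolynomial.aeval _ (MvPolynomial.X j)
      rw [MvPolynomial.aeval_X]
  rw [h2] at h1
  exact flat_of_flatVia_aeval (R := R) (C := C) le_rfl _ h1

variable {S X Y W : Scheme.{u}} [IsLocallyNoetherian S] {α : X ⟶ S} {β : Y ⟶ S} {n : ℕ}
  {f : W ⟶ X} {g : W ⟶ Y} {F : W.Modules}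

lemma flatVia_app_of_forall_flatVia_app [IsFinite f] [IsFinite g]
    (hα : IsSmoothEquidimensional α n) (hβ : IsSmoothEquidimensional β n)
    (hfg : f ≫ α = g ≫ β) (hF : IsCoherent F)
    (h : ∀ x : X, ∃ (U₀ : X.Opens) (_ : x ∈ U₀), ∀ (U : X.Opens) (_ : IsAffineOpen U) (_ : U ≤ U₀),
      FlatVia (f.app U).hom Γ(F, f ⁻¹ᵁ U)) (y : Y) :
    ∃ (V : Y.Opens) (_ : y ∈ V) (_ : IsAffineOpen V), FlatVia (g.app V).hom Γ(F, g ⁻¹ᵁ V) := by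
  have : Smooth α := hα.smooth
  have : Smooth β := hβ.smooth
  have : IsLocallyNoetherian Y := LocallyOfFiniteType.isLocallyNoetherian β
  have : IsLocallyNoetherian W := LocallyOfFiniteType.isLocallyNoetherian g
  obtain ⟨_, ⟨S₀, hS₀, rfl⟩, hyS₀, -⟩ :=
    S.isBasis_affineOpens.exists_subset_of_mem_open (Set.mem_univ (β y)) isOpen_univ
  obtain ⟨m, hm⟩ := exists_hasRelativeDimensionAt β y
  obtain rfl := hm.eq_of_isSmoothEquidimensional hβ
  obtain ⟨V, hV, hyV, -, eV, hVm⟩ := hm.exists_of_mem hS₀ hyS₀ (U := ⊤) trivial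
  refine ⟨V, hyV, hV, ?_⟩
  have hgV : IsAffineOpen (g ⁻¹ᵁ V) := hV.preimage g
  refine (isLocalizingOn_of_isQuasicoherent hgV hF.quasicoherent).flatVia_of_basicOpen hgV
    fun w hw ↦ ?_
  have hαβ : α (f w) = β (g w) := by
    rw [← Scheme.Hom.comp_apply, hfg, Scheme.Hom.comp_apply]
  have hwS₀ : α (f w) ∈ S₀ := hαβ ▸ eV hw
  obtain ⟨U₀, hU₀, hflat⟩ := h (f w)
  obtain ⟨m', hm'⟩ := exists_hasRelativeDimensionAt α (f w)
  -- Both charts now have the same number of étale coordinates, which is where the equality of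
  -- relative dimensions is used.
  obtain rfl := hm'.eq_of_isSmoothEquidimensional hα
  obtain ⟨U, hU, hwU, hle, eU, hUm⟩ := hm'.exists_of_mem hS₀ hwS₀ hU₀
  have hfU : IsAffineOpen (f ⁻¹ᵁ U) := hU.preimage f
  obtain ⟨d, d', hdd', hwd⟩ := exists_basicOpen_le_affine_inter hfU hgV w ⟨hwU, hw⟩
  refine ⟨d', hdd' ▸ hwd, ?_⟩
  have h1 := (isLocalizingOn_of_isQuasicoherent hfU hF.quasicoherent).flatVia_basicOpen
    (hflat U hU hle) d
  -- One open is basic for `f ⁻¹ᵁ U` through `d` and for `g ⁻¹ᵁ V` through `d'`; quantifying over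
  -- `O` carries flatness along the equality of the two.
  have h2 : ∀ (O : W.Opens) (hO : O = W.basicOpen d), FlatVia (f.appLE U O
      (hO.le.trans (W.basicOpen_le d))).hom Γ(F, O) := by
    rintro _ rfl
    exact h1
  have hO : IsAffineOpen (W.basicOpen d') := hgV.basicOpen d'
  have : IsNoetherianRing Γ(W, W.basicOpen d') := IsLocallyNoetherian.component_noetherian ⟨_, hO⟩
  have : IsNoetherianRing Γ(Y, V) := IsLocallyNoetherian.component_noetherian ⟨V, hV⟩
  have : Module.Finite Γ(W, W.basicOpen d') Γ(F, W.basicOpen d') := hF.finite ⟨_, hO⟩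
  have eU' : W.basicOpen d' ≤ f ⁻¹ᵁ U := hdd' ▸ W.basicOpen_le d
  have hcomm : (f.appLE U (W.basicOpen d') eU').hom.comp (α.appLE S₀ U eU).hom =
      (g.appLE V (W.basicOpen d') (W.basicOpen_le d')).hom.comp (β.appLE S₀ V eV).hom := by
    rw [← CommRingCat.hom_comp, ← CommRingCat.hom_comp, Scheme.Hom.appLE_comp_appLE,
      Scheme.Hom.appLE_comp_appLE]
    congr 1
    simp only [hfg]
  refine flatVia_of_isStandardSmoothOfRelativeDimension
    (q := (g.appLE V (W.basicOpen d') (W.basicOpen_le d')).hom) hcomm hUm hVm ?_ ?_ (h2 _ hdd'.symm)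
  · rw [← CommRingCat.hom_comp, Scheme.Hom.appLE_comp_appLE]
    exact (f ≫ α).finiteType_appLE hS₀ hO _
  · exact LocallyQuasiFinite.quasiFinite_appLE hV hO _

end Transfer

/-! ### From finite flat to locally free. -/

section Free

variable {X : Scheme.{u}}

/-- A finitely presented flat module is free over the local ring at `x`, and by finite presentation
freeness spreads to a basic neighbourhood. -/
lemma exists_basicOpen_free {M : X.Modules} {V : X.Opens} (hV : IsAffineOpen V)
    (h : IsLocalizingOn M V) [Module.Flat Γ(X, V) Γ(M, V)]
    [Module.FinitePresentation Γ(X, V) Γ(M, V)] {x : X} (hx : x ∈ V) :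
    ∃ r : Γ(X, V), x ∈ X.basicOpen r ∧
      Module.Free Γ(X, X.basicOpen r) Γ(M, X.basicOpen r) := by
  let p := (hV.primeIdealOf ⟨x, hx⟩).asIdeal
  let Mp := LocalizedModule p.primeCompl Γ(M, V)
  have : Module.Free (Localization p.primeCompl) Mp := Module.free_of_flat_of_isLocalRing
  obtain ⟨r, hr, hfree, -⟩ := Module.FinitePresentation.exists_free_localizedModule_powers
    p.primeCompl (LocalizedModule.mkLinearMap p.primeCompl Γ(M, V)) (Localization p.primeCompl)
  refine ⟨r, ?_, ?_⟩
  · change r ∉ (hV.primeIdealOf ⟨x, hx⟩).asIdeal at hr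
    rw [← PrimeSpectrum.mem_basicOpen, ← hV.fromSpec_preimage_basicOpen] at hr
    change hV.fromSpec (hV.primeIdealOf ⟨x, hx⟩) ∈ X.basicOpen r at hr
    rwa [hV.fromSpec_primeIdealOf] at hr
  · let _ := basicOpenModule (F := M) r
    have := h.isLocalizedModule r
    have := hV.isLocalization_basicOpen r
    -- Freeness is obtained over the model localization; `σ` carries it to the ring of functions,
    -- the identity of `N` being `σ`-semilinear.
    let A := Localization (Submonoid.powers r)
    let N := Γ(M, X.basicOpen r)
    let σ : A ≃ₐ[Γ(X, V)] Γ(X, X.basicOpen r) := IsLocalization.algEquiv (.powers r) _ _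
    let _ : Module A N := Module.compHom N (σ : A →+* Γ(X, X.basicOpen r))
    have : IsScalarTower Γ(X, V) A N := .of_algebraMap_smul fun a m ↦ by
      change σ (algebraMap Γ(X, V) A a) • m = resRing (X.basicOpen_le r) a • m
      rw [σ.commutes]
      rfl
    let e := (IsLocalizedModule.iso (.powers r)
      (resBasicOpen M r)).extendScalarsOfIsLocalization (.powers r) A
    have : Module.Free A N := .of_equiv e
    have := RingHomInvPair.of_ringEquiv σ.toRingEquiv
    have := RingHomInvPair.of_ringEquiv σ.toRingEquiv.symm
    let e' : N ≃ₛₗ[RingHomClass.toRingHom σ.toRingEquiv] N :=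
      { AddEquiv.refl N with map_smul' := fun _ _ ↦ rfl }
    exact Module.Free.of_equiv e'

lemma isLocallyFree_of_forall_flat [IsLocallyNoetherian X] {M : X.Modules}
    (h : ∀ x : X, ∃ (V : X.Opens) (_ : x ∈ V) (_ : IsAffineOpen V), IsLocalizingOn M V ∧
      (∀ r : Γ(X, V), IsLocalizingOn M (X.basicOpen r)) ∧
      Module.Flat Γ(X, V) Γ(M, V) ∧ Module.Finite Γ(X, V) Γ(M, V)) :
    SheafOfModules.IsLocallyFree.{u} M := by
  refine isLocallyFree_of_free fun x ↦ ?_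
  obtain ⟨V, hx, hV, hloc, hloc', hflat, hfin⟩ := h x
  have : IsNoetherianRing Γ(X, V) := IsLocallyNoetherian.component_noetherian ⟨V, hV⟩
  have : Module.FinitePresentation Γ(X, V) Γ(M, V) := Module.finitePresentation_of_finite _ _
  obtain ⟨r, hxr, hfree⟩ := exists_basicOpen_free hV hloc hx
  exact ⟨X.basicOpen r, hxr, hV.basicOpen r, hloc' r, hfree⟩

end Free

/-! ### One implication, for arbitrary `p` and `q` over `S`. -/

section Main

variable {S X Y P : Scheme.{u}} [IsLocallyNoetherian S] {α : X ⟶ S} {β : Y ⟶ S} {n : ℕ}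
  {p : P ⟶ X} {q : P ⟶ Y} {E : P.Modules}

/-- Stated for any commutative square rather than the fibre product, so that exchanging the two
sides gives the converse. -/
lemma isLocallyFree_pushforward_of_isLocallyFree_pushforward
    (hα : IsSmoothEquidimensional α n) (hβ : IsSmoothEquidimensional β n)
    (hpq : p ≫ α = q ≫ β) (hE : IsCoherent E) (hp : IsFinite (schemeSupportι E ≫ p))
    (hq : IsFinite (schemeSupportι E ≫ q))
    (h : SheafOfModules.IsLocallyFree.{u} ((Scheme.Modules.pushforward p).obj E)) :
    SheafOfModules.IsLocallyFree.{u} ((Scheme.Modules.pushforward q).obj E) := by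
  have : Smooth β := hβ.smooth
  have : IsLocallyNoetherian Y := LocallyOfFiniteType.isLocallyNoetherian β
  let i := schemeSupportι E
  have hk : IsKilledBy i E := isKilledBy_schemeSupportι E
  have hF := hk.isCoherent_restrict hE
  have hcomm : (i ≫ p) ≫ α = (i ≫ q) ≫ β := by
    rw [Category.assoc, Category.assoc, hpq]
  have key := flatVia_app_of_forall_flatVia_app (f := i ≫ p) (g := i ≫ q) hα hβ hcomm hF
    fun x ↦ by
      obtain ⟨U₀, hx, hfree⟩ := exists_free_of_isLocallyFree h x
      refine ⟨U₀, hx, fun U hU hle ↦ ?_⟩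
      have := hfree U hU hle
      have hflat : FlatVia (RingHom.id Γ(X, U)) Γ((Scheme.Modules.pushforward p).obj E, U) :=
        flatVia_algebraMap.mpr inferInstance
      refine hflat.of_equiv (hk.pushforwardEquiv p U).symm fun a m ↦ ?_
      rw [AddEquiv.symm_apply_eq, hk.pushforwardEquiv_smul, AddEquiv.apply_symm_apply]
      rfl
  have hloc {V : Y.Opens} (hV : IsAffineOpen V) :
      IsLocalizingOn ((Scheme.Modules.pushforward q).obj E) V :=
    hk.isLocalizingOn_pushforward q
      (isLocalizingOn_of_isQuasicoherent (hV.preimage (i ≫ q)) hF.quasicoherent)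
  refine isLocallyFree_of_forall_flat fun y ↦ ?_
  obtain ⟨V, hy, hV, hflat⟩ := key y
  refine ⟨V, hy, hV, hloc hV, fun r ↦ hloc (hV.basicOpen r), ?_, ?_⟩
  · have : FlatVia (RingHom.id Γ(Y, V)) Γ((Scheme.Modules.pushforward q).obj E, V) :=
      hflat.of_equiv (hk.pushforwardEquiv q V) fun a m ↦ hk.pushforwardEquiv_smul q V a m
    exact flatVia_algebraMap.mp this
  · have h1 : Module.Finite _ Γ(hk.restrict, (i ≫ q) ⁻¹ᵁ V) := hF.finite ⟨_, hV.preimage (i ≫ q)⟩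
    have h2 := (i ≫ q).finite_app V hV
    let _ := ((i ≫ q).app V).hom.toAlgebra
    have : Module.Finite Γ(Y, V) Γ(schemeSupport E, (i ≫ q) ⁻¹ᵁ V) := h2
    let _ : Module Γ(Y, V) Γ(hk.restrict, (i ≫ q) ⁻¹ᵁ V) :=
      Module.compHom _ ((i ≫ q).app V).hom
    have : IsScalarTower Γ(Y, V) Γ(schemeSupport E, (i ≫ q) ⁻¹ᵁ V)
        Γ(hk.restrict, (i ≫ q) ⁻¹ᵁ V) := .of_algebraMap_smul fun _ _ ↦ rfl
    have h3 : Module.Finite Γ(Y, V) Γ(hk.restrict, (i ≫ q) ⁻¹ᵁ V) :=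
      .trans Γ(schemeSupport E, (i ≫ q) ⁻¹ᵁ V) _
    let e : Γ(hk.restrict, (i ≫ q) ⁻¹ᵁ V) ≃ₗ[Γ(Y, V)]
        Γ((Scheme.Modules.pushforward q).obj E, V) :=
      { hk.pushforwardEquiv q V with map_smul' := fun a m ↦ hk.pushforwardEquiv_smul q V a m }
    exact Module.Finite.equiv e

end Main

end SheafBimodule

theorem mainTheorem5 {S X Y : Scheme.{u}} [IsLocallyNoetherian S]
    (α : X ⟶ S) (β : Y ⟶ S) (n : ℕ)
    (hα : SheafBimodule.IsSmoothEquidimensional α n)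
    (hβ : SheafBimodule.IsSmoothEquidimensional β n)
    (E : (pullback α β).Modules) (hE : SheafBimodule.IsShbimod α β E) :
    SheafBimodule.IsLocallyFreeLeft α β E ↔ SheafBimodule.IsLocallyFreeRight α β E :=
  ⟨SheafBimodule.isLocallyFree_pushforward_of_isLocallyFree_pushforward hα hβ pullback.condition
      hE.coherent hE.finite_left hE.finite_right,
    SheafBimodule.isLocallyFree_pushforward_of_isLocallyFree_pushforward hβ hα
      pullback.condition.symm hE.coherent hE.finite_right hE.finite_left⟩
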